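/- Let $\mathbb{Z}_2=\{e,-e\}$ be the group with two elements, and let $M$ be a finite-dimensional, Hausdorff, second countable smooth manifold (boundary and corners are allowed) with a smooth $\mathbb{Z}_2$-action $\rho$, i.e. diffeomorphisms $\rho_\zeta:M\to M$ with $\rho_\zeta\circ\rho_\xi=\rho_{\zeta\xi}$ for $\zeta,\xi\in\mathbb{Z}_2$. Assume that $M$ is 2-connected: $M$ is nonempty and path connected, with $\pi_1(M)=0$ and $\pi_2(M)=0$. A $\mathbb{Z}_2$-equivariant line bundle over $M$ is a smooth hermitian line bundle $L\to M$ with smooth unitary connection $\nabla$, together with an action $\widehat\rho$ of $\mathbb{Z}_2$ on the total space $L$ by diffeomorphisms, $\widehat\rho_\zeta\circ\widehat\rho_\xi=\widehat\rho_{\zeta\xi}$, that covers $\rho$, is linear and unitary on the fibres, and preserves the connection. A $\mathbb{Z}_2$-equivariant isomorphism $L\to L'$ of two such bundles is a smooth isomorphism of line bundles covering $\mathrm{id}_M$ that preserves the hermitian metrics and the connections and intertwines the $\mathbb{Z}_2$-actions. For a smooth real 1-form $A$ on $M$ with $\rho_\zeta^*A=A$ for all $\zeta\in\mathbb{Z}_2$,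 and a choice of sign $\pm$, let $(M\times\mathbb{C},A,\widehat\rho_\pm)$ denote the $\mathbb{Z}_2$-equivariant line bundle consisting of the trivial hermitian line bundle $M\times\mathbb{C}$ with connection $d+\frac{1}{i}A$ and the action $$\widehat\rho_{\pm,\zeta}(m,z)=\bigl(\rho_\zeta(m),(\pm1)^{\varepsilon_\zeta}z\bigr),\qquad \varepsilon_e=0,\quad \varepsilon_{-e}=1.$$ Then every $\mathbb{Z}_2$-equivariant line bundle over $M$ is $\mathbb{Z}_2$-equivariantly isomorphic to $(M\times\mathbb{C},A,\widehat\rho_+)$ or to $(M\times\mathbb{C},A,\widehat\rho_-)$ for some $\mathbb{Z}_2$-invariant smooth real 1-form $A$ on $M$. -/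

import Mathlib

open scoped Manifold ContDiff Topology
open Bundle

noncomputable section

namespace Z2Bundle

/-- A space is 2-connected if it is nonempty and path connected with trivial fundamental group
(`SimplyConnectedSpace`), and its second homotopy group vanishes at every base point. -/
def IsTwoConnected (X : Type*) [TopologicalSpace X] : Prop :=
  SimplyConnectedSpace X ∧ ∀ x : X, Subsingleton (HomotopyGroup.Pi 2 X x)

section Definitions

variable {E : Type*} [NormedAddCommGroup E] [NormedSpace ℝ E]
  {H : Type*} [TopologicalSpace H] (I : ModelWithCorners ℝ E H)
  {M : Type*} [TopologicalSpace M] [ChartedSpace H M]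

/-- An action of `ℤ₂ = {1, -1} = ℤˣ` on `M` is smooth if each element acts by a smooth map
(hence by a diffeomorphism, since the group elements are invertible). -/
class IsSmoothAction (M : Type*) [TopologicalSpace M] [ChartedSpace H M]
    [MulAction ℤˣ M] : Prop where
  contMDiff_smul : ∀ ζ : ℤˣ, ContMDiff I I ∞ (fun m : M => ζ • m)

section Bundle

variable (L : M → Type*) [∀ m, NormedAddCommGroup (L m)] [∀ m, InnerProductSpace ℂ (L m)]
  [TopologicalSpace (TotalSpace ℂ L)] [FiberBundle ℂ L]

/-- `L` (a bundle over `M` with model fibre `ℂ` whose fibres are complex Hilbert spaces) is a smooth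
hermitian line bundle: its local trivialisations are complex linear, the transition functions
are smooth, and the hermitian metric on the fibres varies smoothly.  (Smoothness is with respect to
the real manifold `M`.) -/
class IsHermitianLineBundle [VectorBundle ℝ ℂ L] : Prop where
  vectorBundle_complex : VectorBundle ℂ ℂ L
  contMDiffVectorBundle : ContMDiffVectorBundle ∞ ℂ L I
  contMDiffMetric : ∃ g : ∀ m, L m →L[ℝ] L m →L[ℝ] ℂ,
    ContMDiff I (I.prod 𝓘(ℝ, ℂ →L[ℝ] ℂ →L[ℝ] ℂ)) ∞
      (fun m => TotalSpace.mk' (ℂ →L[ℝ] ℂ →L[ℝ] ℂ)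
        (E := fun m => L m →L[ℝ] L m →L[ℝ] Bundle.Trivial M ℂ m) m (g m)) ∧
    ∀ (m : M) (v w : L m), inner ℂ v w = g m v w

/-- A smooth unitary connection on a hermitian line bundle, as a covariant derivative:
`∇ σ m v` is the derivative of the section `σ` at `m` in the direction `v`. -/
structure UnitaryConnection [IsManifold I ∞ M] [VectorBundle ℝ ℂ L] extends
    CovariantDerivative I ℂ L where
  /-- the Leibniz rule for complex valued functions -/
  leibniz_complex : ∀ (g : M → ℂ) (σ : ∀ m, L m) (m : M),
    MDifferentiableAt I 𝓘(ℝ, ℂ) g m →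
    MDifferentiableAt I (I.prod 𝓘(ℝ, ℂ)) (fun m => TotalSpace.mk' ℂ m (σ m)) m →
    ∀ v : TangentSpace I m,
      toFun (fun m => g m • σ m) m v = g m • toFun σ m v + mvfderiv I g m v • σ m
  /-- compatibility with the hermitian metric -/
  metric : ∀ (σ τ : ∀ m, L m) (m : M),
    MDifferentiableAt I (I.prod 𝓘(ℝ, ℂ)) (fun m => TotalSpace.mk' ℂ m (σ m)) m →
    MDifferentiableAt I (I.prod 𝓘(ℝ, ℂ)) (fun m => TotalSpace.mk' ℂ m (τ m)) m →
    ∀ v : TangentSpace I m,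
      mvfderiv I (fun m => inner ℂ (σ m) (τ m)) m v =
        inner ℂ (toFun σ m v) (τ m) + inner ℂ (σ m) (toFun τ m v)
  /-- the covariant derivative of a smooth section is smooth -/
  smooth : CovariantDerivative.ContMDiffCovariantDerivative toCovariantDerivative ∞

variable {I L}
variable [IsManifold I ∞ M] [VectorBundle ℝ ℂ L]

/-- The structure of a `ℤ₂`-equivariant line bundle on the hermitian line bundle `L` with unitary
connection `nabla`: an action of `ℤ₂` on the total space by smooth maps which covers the action on
the base, is linear and unitary on the fibres, and preserves the connection. -/
structure EquivariantStructure [MulAction ℤˣ M] (nabla : UnitaryConnection I L) where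
  /-- the action of `ζ`, as a unitary map from the fibre over `m` to the fibre over `ζ • m` -/
  toFun : ∀ (ζ : ℤˣ) (m : M), L m ≃ₗᵢ[ℂ] L (ζ • m)
  smooth : ∀ ζ : ℤˣ, ContMDiff (I.prod 𝓘(ℝ, ℂ)) (I.prod 𝓘(ℝ, ℂ)) ∞
    (fun p : TotalSpace ℂ L => TotalSpace.mk' ℂ (E := L) (ζ • p.proj) (toFun ζ p.proj p.snd))
  /-- the action law `ρ̂ ζ (ρ̂ ξ p) = ρ̂ (ζ * ξ) p`, as an equality in the total space -/
  map_mul : ∀ (ζ ξ : ℤˣ) (m : M) (z : L m),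
    TotalSpace.mk' ℂ (E := L) (ζ • ξ • m) (toFun ζ (ξ • m) (toFun ξ m z)) =
      TotalSpace.mk' ℂ (E := L) ((ζ * ξ) • m) (toFun (ζ * ξ) m z)
  /-- the pullback of the connection along the action is the connection itself -/
  connection : ∀ (ζ : ℤˣ) (m : M) (σ : ∀ m, L m),
    MDifferentiableAt I (I.prod 𝓘(ℝ, ℂ)) (fun m => TotalSpace.mk' ℂ m (σ m)) (ζ • m) →
    ∀ v : TangentSpace I m,
      toFun ζ m (nabla.toFun (fun m' => (toFun ζ m').symm (σ (ζ • m'))) m v) =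
        nabla.toFun σ (ζ • m) (mfderiv I I (fun m' : M => ζ • m') m v)

variable {L' : M → Type*} [∀ m, NormedAddCommGroup (L' m)] [∀ m, InnerProductSpace ℂ (L' m)]
  [TopologicalSpace (TotalSpace ℂ L')] [FiberBundle ℂ L'] [VectorBundle ℝ ℂ L']

/-- A `ℤ₂`-equivariant isomorphism of hermitian line bundles with unitary connection over `M`
(covering the identity of `M`). -/
structure EquivariantIso [MulAction ℤˣ M]
    {nabla : UnitaryConnection I L} {nabla' : UnitaryConnection I L'}
    (ρ : EquivariantStructure nabla) (ρ' : EquivariantStructure nabla') where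
  /-- the unitary maps between the fibres -/
  toFun : ∀ m : M, L m ≃ₗᵢ[ℂ] L' m
  smooth : ContMDiff (I.prod 𝓘(ℝ, ℂ)) (I.prod 𝓘(ℝ, ℂ)) ∞
    (fun p : TotalSpace ℂ L => TotalSpace.mk' ℂ (E := L') p.proj (toFun p.proj p.snd))
  smooth_symm : ContMDiff (I.prod 𝓘(ℝ, ℂ)) (I.prod 𝓘(ℝ, ℂ)) ∞
    (fun p : TotalSpace ℂ L' => TotalSpace.mk' ℂ (E := L) p.proj ((toFun p.proj).symm p.snd))
  /-- the isomorphism intertwines the connections -/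
  connection : ∀ (m : M) (σ : ∀ m, L m),
    MDifferentiableAt I (I.prod 𝓘(ℝ, ℂ)) (fun m => TotalSpace.mk' ℂ m (σ m)) m →
    ∀ v : TangentSpace I m,
      nabla'.toFun (fun m' => toFun m' (σ m')) m v = toFun m (nabla.toFun σ m v)
  /-- the isomorphism intertwines the actions -/
  equivariant : ∀ (ζ : ℤˣ) (m : M) (z : L m),
    toFun (ζ • m) (ρ.toFun ζ m z) = ρ'.toFun ζ m (toFun m z)

end Bundle

section Trivial

variable (M) in
/-- A smooth real 1-form `A` on `M` that is invariant under the action of `ℤ₂`. -/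
structure InvariantOneForm [IsManifold I ∞ M] [MulAction ℤˣ M] where
  toFun : ∀ m : M, TangentSpace I m →L[ℝ] ℝ
  smooth : ContMDiff I (I.prod 𝓘(ℝ, E →L[ℝ] ℝ)) ∞
    (fun m => TotalSpace.mk' (E →L[ℝ] ℝ)
      (E := fun m : M => TangentSpace I m →L[ℝ] Bundle.Trivial M ℝ m) m (toFun m))
  invariant : ∀ (ζ : ℤˣ) (m : M) (v : TangentSpace I m),
    toFun (ζ • m) (mfderiv I I (fun m' : M => ζ • m') m v) = toFun m v

variable {I}

lemma mdifferentiableAt_of_section {σ : M → ℂ} {m : M}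
    (h : MDifferentiableAt I (I.prod 𝓘(ℝ, ℂ))
      (fun m => TotalSpace.mk' ℂ (E := Bundle.Trivial M ℂ) m (σ m)) m) :
    MDifferentiableAt I 𝓘(ℝ, ℂ) σ m :=
  ((mdifferentiableAt_section I _).1 h)

lemma contMDiffOn_of_section {σ : M → ℂ} {s : Set M}
    (h : ContMDiffOn I (I.prod 𝓘(ℝ, ℂ)) ∞
      (fun m => TotalSpace.mk' ℂ (E := Bundle.Trivial M ℂ) m (σ m)) s) :
    ContMDiffOn I 𝓘(ℝ, ℂ) ∞ σ s := by
  intro x hx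
  exact ((contMDiffWithinAt_section).1 (h x hx))

lemma hasMFDerivAt_of_mvfderiv {f : M → ℂ} {m : M} (hf : MDifferentiableAt I 𝓘(ℝ, ℂ) f m) :
    HasMFDerivAt I 𝓘(ℝ, ℂ) f m (mvfderiv I f m) :=
  hf.hasMFDerivAt

lemma mvfderiv_complex_mul {f g : M → ℂ} {m : M} (hf : MDifferentiableAt I 𝓘(ℝ, ℂ) f m)
    (hg : MDifferentiableAt I 𝓘(ℝ, ℂ) g m) (v : TangentSpace I m) :
    mvfderiv I (fun m => f m * g m) m v = f m * mvfderiv I g m v + mvfderiv I f m v * g m := by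
  have h := ((hasMFDerivAt_of_mvfderiv hf).mul' (hasMFDerivAt_of_mvfderiv hg)).mfderiv
  exact congrArg (fun T => T v) h

lemma hasMFDerivAt_conj {f : M → ℂ} {m : M} (hf : MDifferentiableAt I 𝓘(ℝ, ℂ) f m) :
    HasMFDerivAt I 𝓘(ℝ, ℂ) (fun m => (starRingEnd ℂ) (f m)) m
      ((Complex.conjCLE : ℂ →L[ℝ] ℂ).comp (mvfderiv I f m)) :=
  ((Complex.conjCLE : ℂ →L[ℝ] ℂ).hasMFDerivAt (x := f m)).comp m hf.hasMFDerivAt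

lemma mvfderiv_conj {f : M → ℂ} {m : M} (hf : MDifferentiableAt I 𝓘(ℝ, ℂ) f m)
    (v : TangentSpace I m) :
    mvfderiv I (fun m => (starRingEnd ℂ) (f m)) m v = (starRingEnd ℂ) (mvfderiv I f m v) :=
  congrArg (fun T => T v) (hasMFDerivAt_conj hf).mfderiv

/-- The trivial hermitian line bundle `M × ℂ`. -/
instance : IsHermitianLineBundle I (Bundle.Trivial M ℂ) where
  vectorBundle_complex := inferInstance
  contMDiffVectorBundle := inferInstance
  contMDiffMetric := by
    refine ⟨fun _ => (ContinuousLinearMap.mul ℝ ℂ).comp (Complex.conjCLE : ℂ →L[ℝ] ℂ),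
      fun x => ?_, fun m v w => ?_⟩
    · rw [contMDiffAt_section]
      convert! contMDiffAt_const
        (c := (ContinuousLinearMap.mul ℝ ℂ).comp (Complex.conjCLE : ℂ →L[ℝ] ℂ))
      ext v w
      simp [hom_trivializationAt_apply, ContinuousLinearMap.inCoordinates]
    · simp [mul_comm]

variable [IsManifold I ∞ M] [MulAction ℤˣ M]

/-- The connection `d + A / i` on the trivial bundle `M × ℂ`, for an invariant 1-form `A`. -/
def trivialConnection (A : InvariantOneForm I M) : UnitaryConnection I (Bundle.Trivial M ℂ) where
  toFun σ m := mvfderiv I (F := ℂ) σ m +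
    (A.toFun m).smulRight ((1 / Complex.I) * (σ m : ℂ))
  isCovariantDerivativeOnUniv := by
    refine ⟨fun {σ σ' x} h h' _ => ?_, fun {σ g x} h hg _ => ?_⟩
    · have h1 := mdifferentiableAt_of_section h
      have h2 := mdifferentiableAt_of_section h'
      have h3 := mvfderiv_add h1 h2
      ext v
      have h4 := congrArg (fun T => T v) h3
      simp only [add_apply] at h4
      simp only [add_apply, ContinuousLinearMap.smulRight_apply, h4,
        Pi.add_apply, Complex.real_smul]
      ring
    · have h1 := mdifferentiableAt_of_section h
      have h3 := mvfderiv_smul hg h1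
      ext v
      have h4 := congrArg (fun T => T v) h3
      simp at h4
      simp [h4]
      ring
  leibniz_complex g σ m hg hσ v := by
    have h1 := mdifferentiableAt_of_section hσ
    have h3 := mvfderiv_complex_mul hg h1 v
    simp [h3]
    ring
  metric σ τ m hσ hτ v := by
    have h1 := mdifferentiableAt_of_section hσ
    have h2 := mdifferentiableAt_of_section hτ
    have h3 := mvfderiv_complex_mul h2 (hasMFDerivAt_conj h1).mdifferentiableAt v
    have h4 := mvfderiv_conj h1 v
    simp [h3, h4]
    ring
  smooth := by
    refine ⟨⟨fun {σ} hσ => fun x _ => ?_⟩⟩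
    have h1 : ContMDiffAt I 𝓘(ℝ, ℂ) ∞ (σ : M → ℂ) x :=
      (contMDiffOn_of_section hσ x (Set.mem_univ x)).contMDiffAt Filter.univ_mem
    have h2 := h1.mfderiv_const (m := ∞) le_rfl
    have h3 := ((contMDiffAt_hom_bundle _).1 (A.smooth x)).2
    refine ContMDiffAt.contMDiffWithinAt ((contMDiffAt_hom_bundle _).2 ⟨contMDiffAt_id, ?_⟩)
    have h4 : ContMDiffAt I 𝓘(ℝ, ℂ) ∞ (fun m => (1 / Complex.I) * (σ m : ℂ)) x :=
      (ContinuousLinearMap.mul ℝ ℂ (1 / Complex.I)).contMDiff.contMDiffAt.comp x h1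
    have h6 : ContMDiff 𝓘(ℝ, E →L[ℝ] ℝ) 𝓘(ℝ, ℂ →L[ℝ] E →L[ℝ] ℂ) ∞
      (fun T : E →L[ℝ] ℝ => ContinuousLinearMap.smulRightL ℝ E ℂ T) :=
      (ContinuousLinearMap.contDiff _).contMDiff
    have h7 : ContMDiffAt I 𝓘(ℝ, ℂ →L[ℝ] E →L[ℝ] ℂ) ∞ _ x := h6.contMDiffAt.comp x h3
    have h5 := h2.add (h7.clm_apply h4)
    refine h5.congr_of_eventuallyEq (Filter.Eventually.of_forall fun m => ?_)
    ext v
    simp [inTangentCoordinates, ContinuousLinearMap.inCoordinates]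
    rfl

/-- `ε ζ` is `0` for the neutral element of `ℤ₂` and `1` for the other element. -/
def eps (ζ : ℤˣ) : ℕ := if ζ = 1 then 0 else 1

/-- The character `ζ ↦ s ^ ε ζ` of `ℤ₂` given by a sign `s = ±1`, with values in `ℂ`. -/
def character (s ζ : ℤˣ) : ℂ := (((s : ℤ) : ℂ)) ^ eps ζ

lemma character_mul (s ζ ξ : ℤˣ) : character s (ζ * ξ) = character s ζ * character s ξ := by
  rcases Int.units_eq_one_or s with rfl | rfl <;> rcases Int.units_eq_one_or ζ with rfl | rfl <;>
    rcases Int.units_eq_one_or ξ with rfl | rfl <;> simp [character, eps]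

lemma norm_character (s ζ : ℤˣ) : ‖character s ζ‖ = 1 := by
  rcases Int.units_eq_one_or s with rfl | rfl <;> simp [character]

lemma character_ne_zero (s ζ : ℤˣ) : character s ζ ≠ 0 := by
  have := norm_character s ζ
  intro h
  simp [h] at this

/-- Multiplication by the value of a character, as a unitary map of `ℂ`. -/
def characterIso (s ζ : ℤˣ) : ℂ ≃ₗᵢ[ℂ] ℂ where
  toLinearEquiv := LinearEquiv.smulOfNeZero ℂ ℂ (character s ζ) (character_ne_zero s ζ)
  norm_map' z := by simp [norm_character]

@[simp] lemma characterIso_apply (s ζ : ℤˣ) (z : ℂ) :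
    characterIso s ζ z = character s ζ * z := rfl

/-- The equivariant line bundle `(M × ℂ, A, ρ̂_s)` for `s = ±1`: the trivial bundle with connection
`d + A / i` on which `ζ` acts by `(m, z) ↦ (ζ • m, s ^ ε ζ * z)`. -/
def trivialAction [IsSmoothAction I M] (A : InvariantOneForm I M) (s : ℤˣ) :
    EquivariantStructure (I := I) (trivialConnection A) where
  toFun ζ _ := characterIso s ζ
  smooth ζ := by
    intro p
    have h0 : ContMDiffAt (I.prod 𝓘(ℝ, ℂ)) (I.prod 𝓘(ℝ, ℂ)) ∞
      (id : TotalSpace ℂ (Bundle.Trivial M ℂ) → TotalSpace ℂ (Bundle.Trivial M ℂ)) p :=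
      contMDiffAt_id
    have h1 := contMDiffAt_totalSpace.1 h0
    refine contMDiffAt_totalSpace.2
      ⟨(IsSmoothAction.contMDiff_smul (I := I) ζ).contMDiffAt.comp p h1.1, ?_⟩
    exact (ContinuousLinearMap.mul ℝ ℂ (character s ζ)).contMDiff.contMDiffAt.comp p h1.2
  map_mul ζ ξ m z := by
    simp [smul_smul, character_mul, mul_assoc]
  connection ζ m σ hσ v := by
    have h1 : MDifferentiableAt I 𝓘(ℝ, ℂ) (σ : M → ℂ) (ζ • m) := mdifferentiableAt_of_section hσ
    have h2 : MDifferentiableAt I I (fun m' : M => ζ • m') m :=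
      (IsSmoothAction.contMDiff_smul (I := I) ζ).mdifferentiableAt (by simp)
    have h3 : mvfderiv I ((σ : M → ℂ) ∘ (fun m' : M => ζ • m')) m v =
        mvfderiv I (σ : M → ℂ) (ζ • m) (mfderiv I I (fun m' : M => ζ • m') m v) :=
      mfderiv_comp_apply m h1 h2 v
    have h4 := mvfderiv_complex_mul (mdifferentiableAt_const (c := (character s ζ)⁻¹))
      (h1.comp m h2) v
    have h5 : (fun m' : M => (characterIso s ζ).symm (σ (ζ • m'))) =
      fun m' => (character s ζ)⁻¹ * ((σ : M → ℂ) ∘ (fun m' : M => ζ • m')) m' := by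
      funext m'
      rw [LinearIsometryEquiv.symm_apply_eq]
      simp [character_ne_zero]
    have h6 : mvfderiv I (fun m' : M => (characterIso s ζ).symm (σ (ζ • m'))) m v =
        (character s ζ)⁻¹ *
          mvfderiv I (σ : M → ℂ) (ζ • m) (mfderiv I I (fun m' : M => ζ • m') m v) := by
      rw [h5]
      refine h4.trans ?_
      rw [mvfderiv_const, ← h3]
      simp only [zero_apply, zero_mul, add_zero]
    have h7 := congrFun h5 m
    simp only [Function.comp_apply] at h7
    have h8 := character_ne_zero s ζ
    simp only [trivialConnection, add_apply, ContinuousLinearMap.smulRight_apply, h6, h7,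
      characterIso_apply, Complex.real_smul, A.invariant]
    field_simp

end Trivial

end Definitions

end Z2Bundle

end

/-!
The theorem holds because a complex line bundle `L` over a 2-connected space `M` is trivial. A
global unit frame `σ` can then be corrected so that `ℤ₂` acts on it by a character, and the
connection is determined by its connection form with respect to `σ`.

*Triviality.* The nonzero vectors of `L` form a principal `ℂˣ`-bundle `P → M`, and maps from
contractible compact spaces to `M` lift to `P` (`exists_lift_frames`). Two points `p`, `q` of one
fibre of `P` are joined by the arcs `t ↦ exp (t z) p` with `exp z p = q`. Lifting squares shows
that, if `π₁(M) = 0`, every homotopy class of paths in `P` from `p` to `q` is the class of an arc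
(`IsPrincipal.exists_arcClass`); lifting cubes shows that, if `π₂(M) = 0`, the class determines the
parameter `z` (`IsPrincipal.eq_zero_of_arcClass_eq_refl`). This is the part of the long exact
homotopy sequence of `P → M` which says that `P` has the universal cover `P̃ → P` on which `ℂ` acts
with quotient `M`. Two local sections of `P` over simply connected open sets, together with classes
of paths from a base point of `P` to their values, thus differ by a well-defined continuous
`ℂ`-valued function on the overlap whose exponential is the transition function; these functions
satisfy the additive cocycle condition (`IsPrincipal.exists_log_cocycle`). A smooth partition of
unity splits the cocycle, which yields a smooth frame of `L` (`exists_smooth_frame`) and, after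
normalisation, a unit frame.

*Equivariance.* If the generator of `ℤ₂` sends `σ` to `f σ`, then `f` is a function with values in
the unit circle, and `f = exp h` since `M` is simply connected. As the generator squares to the
identity, `h + h ∘ (-1)` is a constant `c` with `exp c = 1`. The generator acts on the frame
`exp (-h / 2) σ` by the sign `exp (c / 2)` (`exists_equivariant_frame`).

*The connection.* The form `A = i ⟨σ, ∇ σ⟩` is real because `∇` is unitary and `σ` has length one
(`inner_nabla`), and it is invariant because the action preserves `∇` and multiplies `σ` by
constants (`connectionForm_invariant`). The isomorphism `L → M × ℂ` sends `v` to `⟨σ, v⟩`.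
-/

noncomputable section

namespace Z2Bundle

/-! ### Logarithms of nonvanishing functions -/

/-- The exponential function with values in the group of nonzero complex numbers. -/
def expUnit (z : ℂ) : ℂˣ := Units.mk0 (Complex.exp z) (Complex.exp_ne_zero z)

@[simp] lemma coe_expUnit (z : ℂ) : (expUnit z : ℂ) = Complex.exp z := rfl

@[simp] lemma expUnit_zero : expUnit 0 = 1 := Units.ext (by simp)

lemma expUnit_add (z w : ℂ) : expUnit (z + w) = expUnit z * expUnit w :=
  Units.ext (by simp [Complex.exp_add])

lemma continuous_expUnit : Continuous expUnit :=
  Units.isEmbedding_val₀.continuous_iff.2 Complex.continuous_exp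

section Log

variable {Y : Type*} [TopologicalSpace Y]

/-- A continuous nonvanishing function on a simply connected, locally path connected space has a
continuous logarithm, with prescribed value at one point. -/
lemma exists_continuous_log [SimplyConnectedSpace Y] [LocallyPathConnectedSpace Y]
    (u : C(Y, ℂˣ)) (y₀ : Y) (z₀ : ℂ) (h : expUnit z₀ = u y₀) :
    ∃ θ : C(Y, ℂ), θ y₀ = z₀ ∧ ∀ y, expUnit (θ y) = u y := by
  obtain ⟨θ, ⟨h0, h1⟩, -⟩ := Complex.isCoveringMapOn_exp.existsUnique_continuousMap_lifts
    (⟨fun y => (u y : ℂ), Units.continuous_val.comp u.continuous⟩ : C(Y, ℂ)) (a₀ := y₀) (e₀ := z₀)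
    (congrArg Units.val h) (fun y => (u y).ne_zero)
  exact ⟨θ, h0, fun y => Units.ext (congrFun h1 y)⟩

/-- Two continuous logarithms of the same function on a connected space which agree at a point
are equal. -/
lemma log_unique [PreconnectedSpace Y] {f g : Y → ℂ} (hf : Continuous f) (hg : Continuous g)
    (h : ∀ y, expUnit (f y) = expUnit (g y)) (y₀ : Y) (h₀ : f y₀ = g y₀) : f = g :=
  Complex.isCoveringMap_exp.eq_of_comp_eq hf hg
    (funext fun y => Subtype.ext (congrArg Units.val (h y))) y₀ h₀

/-- A logarithm of a constant function on a connected space is constant. -/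
lemma log_const [PreconnectedSpace Y] {f : Y → ℂ} (hf : Continuous f) {c : ℂˣ}
    (h : ∀ y, expUnit (f y) = c) (y y' : Y) : f y = f y' :=
  congrFun (log_unique hf continuous_const (g := fun _ => f y')
    (fun y => (h y).trans (h y').symm) y' rfl) y

end Log

/-! ### Fundamental groupoids and maps of squares -/

section Square

open unitInterval

variable {P : Type*} [TopologicalSpace P]

lemma contractibleSpace_unitInterval : ContractibleSpace I :=
  (convex_Icc (0 : ℝ) 1).contractibleSpace ⟨0, by simp⟩

attribute [local instance] contractibleSpace_unitInterval

/-- The two ways along the boundary of a square from one corner to the opposite one are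
homotopic. -/
lemma square_comm (F : C(I × I, P)) {a b c d : P} (γ₁ : Path a b) (γ₂ : Path b d)
    (γ₃ : Path a c) (γ₄ : Path c d) (h₁ : ∀ t, γ₁ t = F (t, 0)) (h₂ : ∀ t, γ₂ t = F (1, t))
    (h₃ : ∀ t, γ₃ t = F (0, t)) (h₄ : ∀ t, γ₄ t = F (t, 1)) :
    (Path.Homotopic.Quotient.mk γ₁).trans (.mk γ₂) =
      (Path.Homotopic.Quotient.mk γ₃).trans (.mk γ₄) := by
  have ha : F (0, 0) = a := by rw [← h₁ 0, γ₁.source]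
  have hb : F (1, 0) = b := by rw [← h₁ 1, γ₁.target]
  have hc : F (0, 1) = c := by rw [← h₃ 1, γ₃.target]
  have hd : F (1, 1) = d := by rw [← h₂ 1, γ₂.target]
  subst ha hb hc hd
  let p₁ : Path ((0 : I), (0 : I)) (1, 0) := ⟨⟨fun t => (t, 0), by fun_prop⟩, rfl, rfl⟩
  let p₂ : Path ((1 : I), (0 : I)) (1, 1) := ⟨⟨fun t => (1, t), by fun_prop⟩, rfl, rfl⟩
  let p₃ : Path ((0 : I), (0 : I)) (0, 1) := ⟨⟨fun t => (0, t), by fun_prop⟩, rfl, rfl⟩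
  let p₄ : Path ((0 : I), (1 : I)) (1, 1) := ⟨⟨fun t => (t, 1), by fun_prop⟩, rfl, rfl⟩
  have e₁ : γ₁ = p₁.map F.continuous := Path.ext (funext h₁)
  have e₂ : γ₂ = p₂.map F.continuous := Path.ext (funext h₂)
  have e₃ : γ₃ = p₃.map F.continuous := Path.ext (funext h₃)
  have e₄ : γ₄ = p₄.map F.continuous := Path.ext (funext h₄)
  rw [e₁, e₂, e₃, e₄, ← Path.Homotopic.Quotient.mk_trans, ← Path.Homotopic.Quotient.mk_trans,
    ← Path.map_trans, ← Path.map_trans, Path.Homotopic.Quotient.eq]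
  exact (SimplyConnectedSpace.paths_homotopic (p₁.trans p₂) (p₃.trans p₄)).map F

end Square

/-! ### Principal bundles for the multiplicative group -/

section Principal

open unitInterval

attribute [local instance] contractibleSpace_unitInterval

variable {X P : Type*} [TopologicalSpace X] [TopologicalSpace P] [MulAction ℂˣ P]

/-- The properties of a principal `ℂˣ`-bundle `pr : P → X` which are used below: the fibres are the
orbits of a free action, the element of `ℂˣ` which relates two points of a fibre depends
continuously on them, and maps from contractible compact spaces to `X` lift to `P`. -/
structure IsPrincipal (pr : P → X) : Prop where
  continuous_proj : Continuous pr
  continuous_smul : Continuous fun q : ℂˣ × P => q.1 • q.2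
  proj_smul : ∀ (u : ℂˣ) p, pr (u • p) = pr p
  free : ∀ (u : ℂˣ) (p : P), u • p = p → u = 1
  exists_ratio : ∃ δ : P × P → ℂˣ, ContinuousOn δ {q | pr q.1 = pr q.2} ∧
    ∀ q : P × P, pr q.1 = pr q.2 → δ q • q.1 = q.2
  exists_lift : ∀ (Y : Type) [TopologicalSpace Y] [CompactSpace Y] [T2Space Y]
    [ContractibleSpace Y] (h : C(Y, X)), ∃ g : C(Y, P), ∀ y, pr (g y) = h y

namespace IsPrincipal

variable {pr : P → X} (hP : IsPrincipal pr)
include hP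

lemma exists_ratio_map {Y : Type*} [TopologicalSpace Y] (f g : C(Y, P))
    (h : ∀ y, pr (f y) = pr (g y)) : ∃ u : C(Y, ℂˣ), ∀ y, u y • f y = g y := by
  obtain ⟨δ, hδ, hδ'⟩ := hP.exists_ratio
  exact ⟨⟨fun y => δ (f y, g y), hδ.comp_continuous (f.continuous.prodMk g.continuous) h⟩,
    fun y => hδ' (f y, g y) (h y)⟩

lemma smul_injective {u v : ℂˣ} {p : P} (h : u • p = v • p) : u = v := by
  have h1 := hP.free (v⁻¹ * u) p (by rw [mul_smul, h, inv_smul_smul])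
  exact (inv_mul_eq_one.1 h1).symm

lemma continuous_smul_map {Y : Type*} [TopologicalSpace Y] {u : Y → ℂˣ} {f : Y → P}
    (hu : Continuous u) (hf : Continuous f) : Continuous fun y => u y • f y :=
  hP.continuous_smul.comp (hu.prodMk hf)

/-- The path `t ↦ exp (t * z) • p` in a fibre. Its end point `q` is a variable, so that no casts
are needed to compose such paths. -/
def arc (p q : P) (z : ℂ) (h : expUnit z • p = q) : Path p q where
  toFun t := expUnit (t * z) • p
  continuous_toFun := hP.continuous_smul_map
    (continuous_expUnit.comp (by fun_prop)) continuous_const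
  source' := by simp
  target' := by simpa using h

/-- The homotopy class of `arc`. -/
def arcClass (p q : P) (z : ℂ) (h : expUnit z • p = q) : Path.Homotopic.Quotient p q :=
  .mk (hP.arc p q z h)

/-- A path in a fibre with a continuous logarithm is homotopic to the arc with the same change of
logarithm. -/
lemma mk_expUnit_path {p q : P} (κ : Path p q) {z w : ℂ} (θ : Path z w)
    (h : ∀ t, κ t = expUnit (θ t - z) • p) (h' : expUnit (w - z) • p = q) :
    Path.Homotopic.Quotient.mk κ = hP.arcClass p q (w - z) h' := by
  let e : C(ℂ, P) := ⟨fun x => expUnit (x - z) • p, hP.continuous_smul_map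
    (continuous_expUnit.comp (by fun_prop)) continuous_const⟩
  have hp : e z = p := by simp [e]
  have hq : e w = q := h'
  let l : Path z w := ⟨⟨fun t => z + t * (w - z), by fun_prop⟩, by simp, by simp⟩
  have h1 := (SimplyConnectedSpace.paths_homotopic θ l).map e
  have h2 : κ = (θ.map e.continuous).cast hp.symm hq.symm := Path.ext (funext h)
  have h3 : hP.arc p q (w - z) h' = (l.map e.continuous).cast hp.symm hq.symm :=
    Path.ext (funext fun t => by simp [arc, e, l])
  rw [arcClass, h2, h3, Path.Homotopic.Quotient.eq]
  exact h1.pathCast _ _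

/-- Every path in a fibre is homotopic to an arc. -/
lemma exists_arcClass_of_fibre {p q : P} (κ : Path p q) (h : ∀ t, pr (κ t) = pr p) :
    ∃ z h', Path.Homotopic.Quotient.mk κ = hP.arcClass p q z h' := by
  -- extend the path constantly to the real line, which is locally path connected
  obtain ⟨u, hu⟩ := hP.exists_ratio_map (ContinuousMap.const ℝ p) κ.extend
    (fun t => (h _).symm)
  have h0 : u 0 = 1 := hP.free _ p (by simpa using hu 0)
  obtain ⟨θ, hθ0, hθ⟩ := exists_continuous_log u 0 0 (by simp [h0])
  let θ' : Path (0 : ℂ) (θ 1) := ⟨⟨fun t => θ t, by fun_prop⟩, by simpa using hθ0, by simp⟩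
  have h' : expUnit (θ 1 - 0) • p = q := by
    rw [sub_zero, hθ]; simpa using hu 1
  refine ⟨_, h', hP.mk_expUnit_path κ θ' (fun t => ?_) h'⟩
  have := hu t
  simp only [ContinuousMap.const_apply] at this
  simp [θ', hθ, this]

lemma arcClass_trans (p q r : P) (z w : ℂ) (h : expUnit z • p = q) (h' : expUnit w • q = r)
    (h'' : expUnit (z + w) • p = r) :
    (hP.arcClass p q z h).trans (hP.arcClass q r w h') = hP.arcClass p r (z + w) h'' := by
  let l₁ : Path (0 : ℂ) z := ⟨⟨fun t => t * z, by fun_prop⟩, by simp, by simp⟩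
  let l₂ : Path z (z + w) := ⟨⟨fun t => z + t * w, by fun_prop⟩, by simp, by simp⟩
  let e : C(ℂ, P) := ⟨fun x => expUnit x • p, hP.continuous_smul_map
    continuous_expUnit continuous_const⟩
  have e0 : p = e 0 := by simp [e]
  have e1 : hP.arc p q z h = (l₁.map e.continuous).cast e0 h.symm := rfl
  have e2 : hP.arc q r w h' = (l₂.map e.continuous).cast h.symm h''.symm := by
    ext t
    simp [arc, e, l₂, expUnit_add, mul_comm (expUnit z), mul_smul, h]
  have e3 : (hP.arc p q z h).trans (hP.arc q r w h') =
      ((l₁.trans l₂).map e.continuous).cast e0 h''.symm := by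
    rw [e1, e2, ← Path.cast_trans, ← Path.map_trans]
  have key := hP.mk_expUnit_path ((hP.arc p q z h).trans (hP.arc q r w h')) (l₁.trans l₂)
    (fun t => by rw [sub_zero]; exact congrFun (congrArg DFunLike.coe e3) t) (by simpa using h'')
  rw [arcClass, arcClass, ← Path.Homotopic.Quotient.mk_trans, key]
  congr 1
  ring

lemma arcClass_zero (p : P) : hP.arcClass p p 0 (by simp) = .refl p := by
  rw [arcClass, ← Path.Homotopic.Quotient.mk_refl]
  congr 1
  ext t
  simp [arc]

/-- Over a simply connected base, all classes of paths between points of a fibre are represented by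
arcs: a null homotopy of the projected loop lifts to a square with three sides in the fibre. -/
lemma exists_arcClass [SimplyConnectedSpace X] {p q : P} (h : pr p = pr q)
    (γ : Path.Homotopic.Quotient p q) : ∃ z h', γ = hP.arcClass p q z h' := by
  induction γ using Path.Homotopic.Quotient.ind with | mk κ => ?_
  -- contract the projected loop, lift the contraction, and correct the lift to start at `κ`
  obtain ⟨H⟩ := SimplyConnectedSpace.paths_homotopic (κ.map hP.continuous_proj)
    ((Path.refl (pr p)).cast rfl h.symm)
  obtain ⟨g, hg⟩ := hP.exists_lift (I × I) H.toContinuousMap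
  replace hg : ∀ y, pr (g y) = H y := hg
  obtain ⟨u, hu⟩ := hP.exists_ratio_map (g.comp ⟨fun t : I => ((0 : I), t), by fun_prop⟩)
    κ.toContinuousMap (fun t => by simp [hg])
  replace hu : ∀ t, u t • g (0, t) = κ t := hu
  let F : C(I × I, P) := ⟨fun y => u y.2 • g y, hP.continuous_smul_map (by fun_prop) (by fun_prop)⟩
  have hF : ∀ y, pr (F y) = H y := fun y => (hP.proj_smul _ _).trans (hg y)
  have hF0 : ∀ t, F (0, t) = κ t := hu
  let γ₁ : Path p (F (1, 0)) := ⟨⟨fun t => F (t, 0), by fun_prop⟩, by simp [hF0], rfl⟩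
  let γ₂ : Path (F (1, 0)) (F (1, 1)) := ⟨⟨fun t => F (1, t), by fun_prop⟩, rfl, rfl⟩
  let γ₄ : Path q (F (1, 1)) := ⟨⟨fun t => F (t, 1), by fun_prop⟩, by simp [hF0], rfl⟩
  have sq := square_comm F γ₁ γ₂ κ γ₄ (fun _ => rfl) (fun _ => rfl) (fun t => (hF0 t).symm)
    (fun _ => rfl)
  obtain ⟨z₁, h₁, e₁⟩ := hP.exists_arcClass_of_fibre γ₁ (fun t => by
    change pr (F (t, 0)) = _; simp [hF])
  obtain ⟨z₂, h₂, e₂⟩ := hP.exists_arcClass_of_fibre γ₂ (fun t => by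
    change pr (F (1, t)) = pr (F (1, 0)); simp [hF])
  obtain ⟨z₄, h₄, e₄⟩ := hP.exists_arcClass_of_fibre γ₄.symm (fun t => by
    change pr (F (σ t, 1)) = pr (F (1, 1)); simp [hF])
  have h₁₂ : expUnit (z₁ + z₂) • p = F (1, 1) := by
    rw [add_comm, expUnit_add, mul_smul, h₁, h₂]
  have h' : expUnit (z₁ + z₂ + z₄) • p = q := by
    rw [add_comm, expUnit_add, mul_smul, h₁₂, h₄]
  refine ⟨z₁ + z₂ + z₄, h', ?_⟩
  rw [← hP.arcClass_trans p _ q (z₁ + z₂) z₄ h₁₂ h₄ h', ← e₄,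
    ← hP.arcClass_trans p _ _ z₁ z₂ h₁ h₂ h₁₂, ← e₁, ← e₂, sq,
    Path.Homotopic.Quotient.mk_symm, Path.Homotopic.Quotient.trans_assoc,
    Path.Homotopic.Quotient.trans_symm, Path.Homotopic.Quotient.trans_refl]

/-- If the second homotopy group of the base vanishes, then a closed arc in a fibre is null
homotopic only if it is constant.  A null homotopy projects to a map of a square which is constant
on the boundary; this map is null homotopic, and the homotopy lifts to a map of a cube five faces
of which lie in the fibre.  These five faces form a disc, on which the fibre coordinate has a
logarithm. -/
lemma eq_zero_of_arcClass_eq_refl (p : P) [Subsingleton (HomotopyGroup.Pi 2 X (pr p))] (z : ℂ)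
    (h : expUnit z • p = p) (hz : hP.arcClass p p z h = .refl p) : z = 0 := by
  rw [arcClass, ← Path.Homotopic.Quotient.mk_refl, Path.Homotopic.Quotient.eq] at hz
  obtain ⟨K⟩ := hz
  have hK0 : ∀ t, K (0, t) = expUnit (t * z) • p := fun t => K.apply_zero t
  have hK1 : ∀ t, K (1, t) = p := fun t => K.apply_one t
  have hKl : ∀ t, K (t, 0) = p := K.source
  have hKr : ∀ t, K (t, 1) = p := K.target
  let f : GenLoop (Fin 2) X (pr p) := ⟨⟨fun y => pr (K (y 0, y 1)),
    hP.continuous_proj.comp (by fun_prop)⟩, by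
      rintro y ⟨i, hi⟩
      fin_cases i <;> rcases hi with hi | hi <;> simp at hi <;>
        simp [hi, hK0, hK1, hKl, hKr, hP.proj_smul]⟩
  have hf : (f : C(Fin 2 → I, X)).HomotopicRel
      ((GenLoop.const : GenLoop (Fin 2) X (pr p)) : C(Fin 2 → I, X)) (Cube.boundary (Fin 2)) :=
    Quotient.exact (s := GenLoop.Homotopic.setoid (Fin 2) (pr p))
      (Subsingleton.elim (α := HomotopyGroup.Pi 2 X (pr p)) ⟦f⟧ ⟦GenLoop.const⟧)
  obtain ⟨Φ⟩ := hf
  have : ContractibleSpace (Fin 2 → I) := Homeomorph.finTwoArrow.contractibleSpace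
  obtain ⟨g, hg⟩ := hP.exists_lift (I × (Fin 2 → I)) Φ.toContinuousMap
  replace hg : ∀ y, pr (g y) = Φ y := hg
  obtain ⟨u, hu⟩ := hP.exists_ratio_map (g.comp ⟨fun y => ((0 : I), y), by fun_prop⟩)
    (⟨fun y => K (y 0, y 1), by fun_prop⟩ : C(Fin 2 → I, P)) (fun y => by simp [hg, f])
  replace hu : ∀ y, u y • g (0, y) = K (y 0, y 1) := hu
  let c : ℝ → I := Set.projIcc 0 1 zero_le_one
  have hc : Continuous c := continuous_projIcc
  have hc0 : ∀ a ≤ 0, c a = 0 := fun a ha => Set.projIcc_of_le_left _ ha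
  have hc1 : ∀ a, 1 ≤ a → c a = 1 := fun a ha => Set.projIcc_of_right_le _ ha
  -- the plane is folded onto the five faces: the unit square covers the top of the cube, the
  -- surrounding annulus covers the sides, and what lies beyond is sent to the bottom edges
  let d : ℝ × ℝ → ℝ := fun x => max (max (-x.1) (x.1 - 1)) (max (-x.2) (x.2 - 1))
  let r : ℝ × ℝ → I × (Fin 2 → I) := fun x => (c (1 - d x), ![c x.1, c x.2])
  have hr : Continuous r := by
    refine Continuous.prodMk (hc.comp (by fun_prop)) (continuous_pi fun i => ?_)
    fin_cases i
    · exact hc.comp continuous_fst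
    · exact hc.comp continuous_snd
  let F : C(ℝ × ℝ, P) := ⟨fun x => u (r x).2 • g (r x),
    hP.continuous_smul_map (by fun_prop) (by fun_prop)⟩
  have hF : ∀ x, pr (F x) = pr p := by
    intro x
    change pr (u (r x).2 • g (r x)) = pr p
    rw [hP.proj_smul, hg]
    by_cases hd : d x ≤ 0
    · have : r x = (1, (r x).2) := Prod.ext (hc1 _ (by linarith)) rfl
      rw [this, Φ.apply_one]
      rfl
    · have hb : (r x).2 ∈ Cube.boundary (Fin 2) := by
        simp only [d, max_le_iff, not_and_or, not_le] at hd
        rcases hd with (hd | hd) | hd | hd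
        · exact ⟨0, .inl (hc0 _ (by linarith))⟩
        · exact ⟨0, .inr (hc1 _ (by linarith))⟩
        · exact ⟨1, .inl (hc0 _ (by linarith))⟩
        · exact ⟨1, .inr (hc1 _ (by linarith))⟩
      have := Φ.eq_fst (r x).1 hb
      rw [Prod.mk.eta] at this
      rw [this]
      exact f.2 _ hb
  have hF1 : ∀ x, 1 ≤ d x → F x = K (c x.1, c x.2) := by
    intro x hx
    have : r x = (0, (r x).2) := Prod.ext (hc0 _ (by linarith)) rfl
    change u (r x).2 • g (r x) = _
    rw [this, hu]
    rfl
  obtain ⟨v, hv⟩ := hP.exists_ratio_map (ContinuousMap.const _ p) F (fun x => (hF x).symm)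
  replace hv : ∀ x, v x • p = F x := hv
  have side : ∀ x w, 1 ≤ d x → K (c x.1, c x.2) = expUnit w • p → v x = expUnit w :=
    fun x w hx hw => hP.smul_injective ((hv x).trans ((hF1 x hx).trans hw))
  obtain ⟨θ, hθ0, hθ⟩ := exists_continuous_log v (-1, -1) 0
    (side (-1, -1) 0 (by norm_num [d]) (by simp [hc0])).symm
  -- the logarithm increases by `z` along one side of the square and is constant along the others
  have s₁ : (fun b : ℝ => θ (-1, b)) = fun b => c b * z := by
    refine log_unique (by fun_prop) (by fun_prop) (fun b => ?_) (-1) (by simp [hθ0, hc0])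
    rw [hθ]
    exact side (-1, b) _ (by norm_num [d]) (by simp [hc0 (-1), hK0])
  have s₂ : θ (-1, 2) = θ (2, 2) := log_const (f := fun a : ℝ => θ (a, 2)) (c := 1)
    (by fun_prop) (fun a => by
      rw [hθ, ← expUnit_zero]
      exact side (a, 2) _ (by norm_num [d]) (by simp [hc1 2])) _ _
  have s₃ : θ (2, 2) = θ (2, -1) := log_const (f := fun b : ℝ => θ (2, b)) (c := 1)
    (by fun_prop) (fun b => by
      rw [hθ, ← expUnit_zero]
      exact side (2, b) _ (by norm_num [d]) (by simp [hc1 2])) _ _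
  have s₄ : θ (2, -1) = θ (-1, -1) := log_const (f := fun a : ℝ => θ (a, -1)) (c := 1)
    (by fun_prop) (fun a => by
      rw [hθ, ← expUnit_zero]
      exact side (a, -1) _ (by norm_num [d]) (by simp [hc0 (-1)])) _ _
  have s₅ := congrFun s₁ 2
  simp only [hc1 2 one_le_two, s₂, s₃, s₄, hθ0] at s₅
  simpa using s₅.symm

/-! ### Logarithms of transition functions over a 2-connected base -/

lemma arcClass_injective (p q : P) [Subsingleton (HomotopyGroup.Pi 2 X (pr p))] {z w : ℂ}
    (hz : expUnit z • p = q) (hw : expUnit w • p = q)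
    (h : hP.arcClass p q z hz = hP.arcClass p q w hw) : z = w := by
  have h1 : expUnit (-w) • q = p := by
    rw [← hw, ← mul_smul, ← expUnit_add, neg_add_cancel, expUnit_zero, one_smul]
  have h2 : expUnit (z + -w) • p = p := by rw [add_comm, expUnit_add, mul_smul, hz, h1]
  have h3 := hP.arcClass_trans p q p z (-w) hz h1 h2
  have h4 := hP.arcClass_trans p q p w (-w) hw h1 (by simp)
  rw [h, h4] at h3
  have h5 := hP.eq_zero_of_arcClass_eq_refl p _ h2 (h3.symm.trans (by
    rw [← hP.arcClass_zero p]; congr 1; simp))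
  linear_combination h5

/-- Two classes of paths in `P` with the same starting point, whose end points lie in one fibre,
differ by the arc with parameter `z`. -/
def Differ {b p q : P} (γ : Path.Homotopic.Quotient b p) (γ' : Path.Homotopic.Quotient b q)
    (z : ℂ) : Prop :=
  ∃ h, γ.trans (hP.arcClass p q z h) = γ'

variable {hP}

lemma Differ.trans {b p q r : P} {γ : Path.Homotopic.Quotient b p}
    {γ' : Path.Homotopic.Quotient b q} {γ'' : Path.Homotopic.Quotient b r} {z w : ℂ}
    (h : hP.Differ γ γ' z) (h' : hP.Differ γ' γ'' w) : hP.Differ γ γ'' (z + w) := by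
  obtain ⟨h₁, rfl⟩ := h
  obtain ⟨h₂, rfl⟩ := h'
  have h₃ : expUnit (z + w) • p = r := by rw [add_comm, expUnit_add, mul_smul, h₁, h₂]
  exact ⟨h₃, by rw [← hP.arcClass_trans p q r z w h₁ h₂ h₃, Path.Homotopic.Quotient.trans_assoc]⟩

lemma Differ.unique {b p q : P} [Subsingleton (HomotopyGroup.Pi 2 X (pr p))]
    {γ : Path.Homotopic.Quotient b p} {γ' : Path.Homotopic.Quotient b q} {z w : ℂ}
    (h : hP.Differ γ γ' z) (h' : hP.Differ γ γ' w) : z = w := by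
  obtain ⟨h₁, e₁⟩ := h
  obtain ⟨h₂, e₂⟩ := h'
  refine hP.arcClass_injective p q h₁ h₂ ?_
  have := congrArg (γ.symm.trans ·) (e₁.trans e₂.symm)
  simpa [← Path.Homotopic.Quotient.trans_assoc] using this

lemma exists_differ [SimplyConnectedSpace X] {b p q : P} (h : pr p = pr q)
    (γ : Path.Homotopic.Quotient b p) (γ' : Path.Homotopic.Quotient b q) :
    ∃ z, hP.Differ γ γ' z := by
  obtain ⟨z, h', e⟩ := hP.exists_arcClass h (γ.symm.trans γ')
  exact ⟨z, h', by rw [← e]; simp [← Path.Homotopic.Quotient.trans_assoc]⟩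

/-- The difference of two classes is transported along paths in `P` over the same path in `X`. -/
lemma Differ.transport {b p q p' q' : P} {γ : Path.Homotopic.Quotient b p}
    {γ' : Path.Homotopic.Quotient b q} (κ : Path p p') (κ' : Path q q') (θ : C(I, ℂ))
    (h : hP.Differ γ γ' (θ 0)) (hθ : ∀ t, expUnit (θ t) • κ t = κ' t) :
    hP.Differ (γ.trans (.mk κ)) (γ'.trans (.mk κ')) (θ 1) := by
  obtain ⟨h₁, rfl⟩ := h
  have h₂ : expUnit (θ 1) • p' = q' := by simpa using hθ 1
  refine ⟨h₂, ?_⟩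
  let F : C(I × I, P) := ⟨fun x => expUnit (x.2 * θ x.1) • κ x.1,
    hP.continuous_smul_map (continuous_expUnit.comp (by fun_prop)) (by fun_prop)⟩
  have sq := square_comm F κ (hP.arc p' q' (θ 1) h₂) (hP.arc p q (θ 0) h₁) κ'
    (fun t => by simp [F]) (fun t => by simp [F, arc]) (fun t => by simp [F, arc])
    (fun t => by simp [F, hθ])
  rw [Path.Homotopic.Quotient.trans_assoc, Path.Homotopic.Quotient.trans_assoc]
  exact congrArg (γ.trans ·) sq

variable (hP)

/-- A path in the base lifts to `P`, and its end point can be moved within the fibre, which is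
path connected. -/
lemma joined [PathConnectedSpace X] (p q : P) : Joined p q := by
  obtain ⟨γ⟩ := PathConnectedSpace.joined (pr p) (pr q)
  obtain ⟨g, hg⟩ := hP.exists_lift I γ.toContinuousMap
  replace hg : ∀ t, pr (g t) = γ t := hg
  obtain ⟨u, hu⟩ := hP.exists_ratio_map (.const Unit (g 0)) (.const Unit p) (by simp [hg])
  replace hu : u () • g 0 = p := hu ()
  obtain ⟨w, hw⟩ := hP.exists_ratio_map (.const Unit (u () • g 1)) (.const Unit q)
    (by simp [hg, hP.proj_smul])
  replace hw : w () • u () • g 1 = q := hw ()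
  have hl : expUnit (Complex.log (w ())) = w () :=
    Units.ext (Complex.exp_log (w ()).ne_zero)
  exact ⟨⟨⟨fun t => expUnit (t * Complex.log (w ())) • u () • g t, hP.continuous_smul_map
    (continuous_expUnit.comp (by fun_prop)) (hP.continuous_smul_map continuous_const (by fun_prop))⟩,
    by simpa using hu, by simpa [hl] using hw⟩⟩

/-- Over a simply connected set, a section of `P` extends to a compatible family of classes of
paths from the base point to its values. -/
lemma exists_pathClasses [PathConnectedSpace X] (b : P) {W : Set X} (hW : IsSimplyConnected W)
    (s : C(W, P)) : ∃ η : ∀ y : W, Path.Homotopic.Quotient b (s y),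
      ∀ (y y' : W) (κ : Path y y'), η y' = (η y).trans (.mk (κ.map s.continuous)) := by
  have := hW.simplyConnectedSpace
  obtain ⟨x⟩ : Nonempty W := inferInstance
  obtain ⟨γ⟩ := hP.joined b (s x)
  refine ⟨fun y => (Path.Homotopic.Quotient.mk γ).trans
    (.mk ((PathConnectedSpace.somePath x y).map s.continuous)), fun y y' κ => ?_⟩
  rw [Path.Homotopic.Quotient.trans_assoc, ← Path.Homotopic.Quotient.mk_trans, ← Path.map_trans]
  exact congrArg (Path.Homotopic.Quotient.mk γ).trans (Path.Homotopic.Quotient.eq.2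
    ((SimplyConnectedSpace.paths_homotopic _ _).map s))

/-- Local sections of a principal `ℂˣ`-bundle over a 2-connected base differ by exponentials of
continuous functions which satisfy the cocycle condition. -/
theorem exists_log_cocycle (hX : IsTwoConnected X)
    (hb : ∀ x : X, ∀ U ∈ 𝓝 x, ∃ V ⊆ U, x ∈ V ∧ IsOpen V ∧ IsSimplyConnected V)
    [LocallyPathConnectedSpace X] {ι : Type*} (W : ι → Set X) (hWo : ∀ i, IsOpen (W i))
    (hW : ∀ i, IsSimplyConnected (W i)) (s : ∀ i, C(W i, P)) (hs : ∀ i y, pr (s i y) = y) :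
    ∃ a : ι → ι → X → ℂ,
      (∀ i j, ContinuousOn (a i j) (W i ∩ W j)) ∧
      (∀ i j y (hi : y ∈ W i) (hj : y ∈ W j),
        expUnit (a i j y) • s i ⟨y, hi⟩ = s j ⟨y, hj⟩) ∧
      ∀ i j k y, y ∈ W i → y ∈ W j → y ∈ W k → a i j y + a j k y = a i k y := by
  classical
  rcases isEmpty_or_nonempty ι with hι | ⟨⟨i₀⟩⟩
  · exact ⟨fun i => hι.elim i, fun i => hι.elim i, fun i => hι.elim i, fun i => hι.elim i⟩
  obtain ⟨hX₁, hX₂⟩ := hX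
  obtain ⟨x₀, hx₀⟩ := (hW i₀).nonempty
  choose η hη using fun i => hP.exists_pathClasses (s i₀ ⟨x₀, hx₀⟩) (hW i) (s i)
  have ex : ∀ i j y, ∃ z, ∀ (hi : y ∈ W i) (hj : y ∈ W j),
      hP.Differ (η i ⟨y, hi⟩) (η j ⟨y, hj⟩) z := by
    intro i j y
    by_cases h : y ∈ W i ∧ y ∈ W j
    · obtain ⟨z, hz⟩ := hP.exists_differ (by rw [hs, hs]) (η i ⟨y, h.1⟩) (η j ⟨y, h.2⟩)
      exact ⟨z, fun _ _ => hz⟩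
    · exact ⟨0, fun hi hj => (h ⟨hi, hj⟩).elim⟩
  choose a ha using ex
  refine ⟨a, fun i j y hy => ?_, fun i j y hi hj => (ha i j y hi hj).1, fun i j k y hi hj hk =>
    ((ha i j y hi hj).trans (ha j k y hj hk)).unique (ha i k y hi hk)⟩
  -- near `y`, the parameter `a i j` agrees with the continuous logarithm of the transition function
  -- which has the same value at `y`
  obtain ⟨V, hVW, hyV, hVo, hV⟩ := hb y _ (((hWo i).inter (hWo j)).mem_nhds hy)
  have := hV.simplyConnectedSpace
  have := hVo.locallyPathConnectedSpace
  let ci : C(V, W i) := ⟨Set.inclusion fun x hx => (hVW hx).1, continuous_inclusion _⟩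
  let cj : C(V, W j) := ⟨Set.inclusion fun x hx => (hVW hx).2, continuous_inclusion _⟩
  obtain ⟨u, hu⟩ := hP.exists_ratio_map ((s i).comp ci) ((s j).comp cj)
    (fun x => by simp only [ContinuousMap.comp_apply, hs]; rfl)
  obtain ⟨θ, hθ0, hθ⟩ := exists_continuous_log u ⟨y, hyV⟩ (a i j y)
    (hP.smul_injective ((ha i j y hy.1 hy.2).1.trans (hu ⟨y, hyV⟩).symm))
  have key : ∀ y' : V, a i j y' = θ y' := by
    intro y'
    let κ := PathConnectedSpace.somePath (⟨y, hyV⟩ : V) y'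
    have h1 := Differ.transport ((κ.map ci.continuous).map (s i).continuous)
      ((κ.map cj.continuous).map (s j).continuous) (θ.comp κ.toContinuousMap)
      (by simpa [hθ0] using ha i j y hy.1 hy.2)
      (fun t => by simpa [hθ] using hu (κ t))
    rw [← hη, ← hη] at h1
    have h2 : (θ.comp κ.toContinuousMap) 1 = θ y' := by simp
    rw [h2] at h1
    exact (ha i j y' _ _).unique h1
  refine ContinuousAt.continuousWithinAt ?_
  refine ContinuousOn.continuousAt (s := V) ?_ (hVo.mem_nhds hyV)
  rw [continuousOn_iff_continuous_domRestrict]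
  exact θ.continuous.congr fun y' => (key y').symm

end IsPrincipal

end Principal

/-! ### The bundle of frames of a complex line bundle -/

section Frame

open unitInterval Filter

variable {X : Type*} [TopologicalSpace X] {L : X → Type*} [∀ x, AddCommGroup (L x)]
  [∀ x, Module ℂ (L x)] [∀ x, TopologicalSpace (L x)] [TopologicalSpace (TotalSpace ℂ L)]
  [FiberBundle ℂ L] [VectorBundle ℂ ℂ L]

lemma coord_smul {x₀ x : X} (hx : x ∈ (trivializationAt ℂ L x₀).baseSet) (c : ℂ) (v : L x) :
    (trivializationAt ℂ L x₀ ⟨x, c • v⟩).2 = c * (trivializationAt ℂ L x₀ ⟨x, v⟩).2 :=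
  ((trivializationAt ℂ L x₀).linear ℂ hx).map_smul c v

lemma coord_sum {x₀ x : X} (hx : x ∈ (trivializationAt ℂ L x₀).baseSet) {ι : Type*}
    (t : Finset ι) (v : ι → L x) :
    (trivializationAt ℂ L x₀ ⟨x, ∑ i ∈ t, v i⟩).2 =
      ∑ i ∈ t, (trivializationAt ℂ L x₀ ⟨x, v i⟩).2 := by
  have := map_sum ((trivializationAt ℂ L x₀).linearMapAt ℂ x) v t
  simpa only [(trivializationAt ℂ L x₀).coe_linearMapAt_of_mem hx] using this

lemma coord_eq_zero {x₀ x : X} (hx : x ∈ (trivializationAt ℂ L x₀).baseSet) {v : L x} :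
    (trivializationAt ℂ L x₀ ⟨x, v⟩).2 = 0 ↔ v = 0 :=
  ((trivializationAt ℂ L x₀).linearEquivAt ℂ x hx).map_eq_zero_iff

lemma coord_injective {x₀ x : X} (hx : x ∈ (trivializationAt ℂ L x₀).baseSet) {v w : L x}
    (h : (trivializationAt ℂ L x₀ ⟨x, v⟩).2 = (trivializationAt ℂ L x₀ ⟨x, w⟩).2) : v = w :=
  ((trivializationAt ℂ L x₀).linearEquivAt ℂ x hx).injective h

omit [∀ x, Module ℂ (L x)] [VectorBundle ℂ ℂ L] in
lemma coord_symm {x₀ x : X} (hx : x ∈ (trivializationAt ℂ L x₀).baseSet) (z : ℂ) :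
    (trivializationAt ℂ L x₀ ⟨x, (trivializationAt ℂ L x₀).symm x z⟩).2 = z :=
  congrArg Prod.snd ((trivializationAt ℂ L x₀).apply_mk_symm hx z)

/-- The fibres are one-dimensional. -/
lemma exists_smul_eq {x : X} {v : L x} (hv : v ≠ 0) (w : L x) : ∃ c : ℂ, c • v = w := by
  have hx := FiberBundle.mem_baseSet_trivializationAt' (F := ℂ) (E := L) x
  refine ⟨(trivializationAt ℂ L x ⟨x, w⟩).2 / (trivializationAt ℂ L x ⟨x, v⟩).2,
    coord_injective hx ?_⟩
  rw [coord_smul hx, div_mul_cancel₀ _ ((coord_eq_zero hx).not.2 hv)]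

lemma coord_eq_mul {x₀ x₁ x : X} (hx : x ∈ (trivializationAt ℂ L x₀).baseSet)
    (hx' : x ∈ (trivializationAt ℂ L x₁).baseSet) (v : L x) :
    (trivializationAt ℂ L x₁ ⟨x, v⟩).2 = (trivializationAt ℂ L x₀ ⟨x, v⟩).2 *
      (trivializationAt ℂ L x₁ ⟨x, (trivializationAt ℂ L x₀).symm x 1⟩).2 := by
  rw [← coord_smul hx']
  congr 3
  exact coord_injective hx (by rw [coord_smul hx, coord_symm hx, mul_one])

omit [∀ x, AddCommGroup (L x)] [∀ x, Module ℂ (L x)] [VectorBundle ℂ ℂ L] in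
lemma continuousAt_coord {Y : Type*} [TopologicalSpace Y] {f : Y → TotalSpace ℂ L} {y : Y}
    (hf : ContinuousAt f y) {x₀ : X} (hy : (f y).proj ∈ (trivializationAt ℂ L x₀).baseSet) :
    ContinuousAt (fun y => (trivializationAt ℂ L x₀ (f y)).2) y :=
  (((trivializationAt ℂ L x₀).continuousAt ((trivializationAt ℂ L x₀).mem_source.2 hy)).comp
    hf).snd

omit [∀ x, Module ℂ (L x)] [VectorBundle ℂ ℂ L] in
lemma continuousAt_symm {Y : Type*} [TopologicalSpace Y] {h : Y → X} {y : Y}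
    (hh : ContinuousAt h y) {x₀ : X} (hy : h y ∈ (trivializationAt ℂ L x₀).baseSet) :
    ContinuousAt (fun y => TotalSpace.mk' ℂ (h y) ((trivializationAt ℂ L x₀).symm (h y) 1)) y := by
  have h1 := (trivializationAt ℂ L x₀).continuousOn_symm.continuousAt (x := (h y, (1 : ℂ)))
    (prod_mem_nhds ((trivializationAt ℂ L x₀).open_baseSet.mem_nhds hy) univ_mem)
  exact h1.comp (f := fun y => (h y, (1 : ℂ))) (hh.prodMk continuousAt_const)

variable (L) in
/-- The nonzero vectors of a complex line bundle, which form its bundle of frames. -/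
abbrev Frames := {p : TotalSpace ℂ L // p.2 ≠ 0}

instance : MulAction ℂˣ (Frames L) where
  smul u p := ⟨⟨p.1.proj, (u : ℂ) • p.1.2⟩, smul_ne_zero u.ne_zero p.2⟩
  one_smul p := Subtype.ext (congrArg (TotalSpace.mk p.1.proj) (one_smul ℂ p.1.2))
  mul_smul u v p := Subtype.ext (congrArg (TotalSpace.mk p.1.proj) (mul_smul (u : ℂ) (v : ℂ) p.1.2))

omit [TopologicalSpace X] [∀ x, TopologicalSpace (L x)] [TopologicalSpace (TotalSpace ℂ L)]
  [FiberBundle ℂ L] [VectorBundle ℂ ℂ L] in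
lemma coe_smul_frame (u : ℂˣ) (p : Frames L) :
    ((u • p : Frames L) : TotalSpace ℂ L) = ⟨p.1.proj, (u : ℂ) • p.1.2⟩ := rfl

/-- Every map from a contractible compact space to the base lifts to the bundle of frames.
A partition of unity on this space, subordinate to a finite cover by preimages of trivialising
sets, gives linear maps between the fibres over any two points, which are the identity on the
diagonal and hence invertible near it. A frame over the constant end of a contraction is
transported by finitely many of these maps along the contraction. -/
lemma exists_lift_frames (Y : Type) [TopologicalSpace Y] [CompactSpace Y] [T2Space Y]
    [ContractibleSpace Y] (h : C(Y, X)) : ∃ g : C(Y, Frames L), ∀ y, (g y).1.proj = h y := by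
  classical
  let V : Y → Set Y := fun i => h ⁻¹' (trivializationAt ℂ L (h i)).baseSet
  have hV : ∀ i, IsOpen (V i) := fun i =>
    (trivializationAt ℂ L (h i)).open_baseSet.preimage h.continuous
  obtain ⟨t, ht⟩ := isCompact_univ.elim_finite_subcover V hV (fun y _ => Set.mem_iUnion.2
    ⟨y, FiberBundle.mem_baseSet_trivializationAt' (F := ℂ) (E := L) (h y)⟩)
  obtain ⟨l, hl⟩ := PartitionOfUnity.exists_isSubordinate isClosed_univ (fun i : t => V i)
    (fun i => hV i) (by simpa only [Set.iUnion_subtype] using ht)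
  have hlV : ∀ (i : t) y, l i y ≠ 0 → y ∈ V i := fun i y hy =>
    hl i (subset_tsupport _ (Function.mem_support.2 hy))
  have hl1 : ∀ y, ∑ i, l i y = 1 := fun y => by
    rw [← finsum_eq_sum_of_fintype]; exact l.sum_eq_one (Set.mem_univ y)
  let e : t → Trivialization ℂ (TotalSpace.proj : TotalSpace ℂ L → X) :=
    fun i => trivializationAt ℂ L (h i)
  -- the linear map from the fibre over `y'` to the fibre over `y`
  let T : ∀ (y y' : Y), L (h y') → L (h y) := fun y y' v =>
    ∑ i : t, ((l i y : ℂ) * (l i y' * (e i ⟨h y', v⟩).2)) • (e i).symm (h y) 1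
  -- products of a function from the partition of unity with a function which is continuous on
  -- its support
  have cmul : ∀ {Z : Type} [TopologicalSpace Z] {φ : Z → Y} (hφ : Continuous φ) (i : t)
      (F : Z → ℂ) (z : Z), (φ z ∈ V i → ContinuousAt F z) →
      ContinuousAt (fun z => (l i (φ z) : ℂ) * F z) z := by
    intro Z _ φ hφ i F z hF
    by_cases hz : φ z ∈ tsupport (l i)
    · exact (Complex.continuous_ofReal.comp ((l i).continuous.comp hφ)).continuousAt.mul
        (hF (hl i hz))
    · refine (continuousAt_const (y := (0 : ℂ))).congr ?_
      filter_upwards [hφ.continuousAt.preimage_mem_nhds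
        ((isClosed_tsupport (l i)).isOpen_compl.mem_nhds hz)] with z' hz'
      rw [image_eq_zero_of_notMem_tsupport hz']
      simp
  have hT : ∀ y₀, ∀ᶠ q : Y × Y in 𝓝 (y₀, y₀), ∀ v : L (h q.2), v ≠ 0 → T q.1 q.2 v ≠ 0 := by
    intro y₀
    let e₀ := trivializationAt ℂ L (h y₀)
    have hy₀ : h y₀ ∈ e₀.baseSet := FiberBundle.mem_baseSet_trivializationAt' (F := ℂ) (E := L) _
    -- the coefficient of `T` in the trivialisation at `h y₀`
    let k : Y × Y → ℂ := fun q => ∑ i : t, (l i q.1 : ℂ) * ((l i q.2 : ℂ) *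
      ((e i ⟨h q.2, e₀.symm (h q.2) 1⟩).2 * (e₀ ⟨h q.1, (e i).symm (h q.1) 1⟩).2))
    have hk : ContinuousAt k (y₀, y₀) := by
      refine tendsto_finsetSum _ fun i _ => cmul continuous_fst i _ _ fun hi =>
        cmul continuous_snd i _ _ fun _ => ?_
      refine ContinuousAt.mul
        (continuousAt_coord (continuousAt_symm (h := fun q : Y × Y => h q.2) (by fun_prop) hy₀) hi)
        (continuousAt_coord (continuousAt_symm (h := fun q : Y × Y => h q.1) (by fun_prop) hi) hy₀)
    have hk0 : k (y₀, y₀) ≠ 0 := by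
      have h1 : k (y₀, y₀) = ((∑ i : t, l i y₀ * l i y₀ : ℝ) : ℂ) := by
        simp only [k, Complex.ofReal_sum, Complex.ofReal_mul]
        refine Finset.sum_congr rfl fun i _ => ?_
        by_cases hi : l i y₀ = 0
        · simp [hi]
        · have h2 := coord_eq_mul hy₀ (hlV i y₀ hi) ((e i).symm (h y₀) 1)
          rw [coord_symm (hlV i y₀ hi)] at h2
          rw [mul_comm ((e i _).2), ← h2, mul_one]
      rw [h1, Complex.ofReal_ne_zero]
      intro h3
      have h4 := (Finset.sum_eq_zero_iff_of_nonneg fun i _ => mul_self_nonneg (l i y₀)).1 h3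
      have h5 := hl1 y₀
      rw [Finset.sum_eq_zero fun i hi => mul_self_eq_zero.1 (h4 i hi)] at h5
      exact zero_ne_one h5
    have hb : h ⁻¹' e₀.baseSet ∈ 𝓝 y₀ := h.continuous.continuousAt.preimage_mem_nhds
      (e₀.open_baseSet.mem_nhds hy₀)
    filter_upwards [hk.eventually_ne hk0, prod_mem_nhds hb hb] with q hq hqb v hv hTv
    have h1 : (e₀ ⟨h q.1, T q.1 q.2 v⟩).2 = (e₀ ⟨h q.2, v⟩).2 * k q := by
      rw [coord_sum hqb.1, Finset.mul_sum]
      refine Finset.sum_congr rfl fun i _ => ?_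
      rw [coord_smul hqb.1]
      by_cases hi : l i q.2 = 0
      · simp [hi]
      · rw [coord_eq_mul hqb.2 (hlV i q.2 hi) v]
        ring
    rw [hTv, (coord_eq_zero hqb.1).2 rfl] at h1
    exact mul_ne_zero ((coord_eq_zero hqb.2).not.2 hv) hq h1.symm
  -- `Lift s` says that the map `h` composed with stage `s` of the contraction lifts to a frame
  obtain ⟨y₁, ⟨H⟩⟩ := id_nullhomotopic Y
  let Lift : I → Prop := fun s => ∃ v : ∀ y, L (h (H (s, y))), (∀ y, v y ≠ 0) ∧
    Continuous fun y => TotalSpace.mk' ℂ (h (H (s, y))) (v y)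
  have step : ∀ s s', (∀ y, ∀ v : L (h (H (s, y))), v ≠ 0 → T (H (s', y)) (H (s, y)) v ≠ 0) →
      Lift s → Lift s' := by
    rintro s s' hss ⟨v, hv0, hv⟩
    refine ⟨fun y => T (H (s', y)) (H (s, y)) (v y), fun y => hss y _ (hv0 y),
      continuous_iff_continuousAt.2 fun y => ?_⟩
    have hy := FiberBundle.mem_baseSet_trivializationAt' (F := ℂ) (E := L) (h (H (s', y)))
    have hHs' : Continuous fun y => H (s', y) := by fun_prop
    refine (FiberBundle.continuousAt_totalSpace ℂ _).2 ⟨by fun_prop, ?_⟩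
    have key : ContinuousAt (fun y' => ∑ i : t, (l i (H (s', y')) : ℂ) * ((l i (H (s, y')) : ℂ) *
        (e i ⟨h (H (s, y')), v y'⟩).2 * (trivializationAt ℂ L (h (H (s', y)))
          ⟨h (H (s', y')), (e i).symm (h (H (s', y'))) 1⟩).2)) y := by
      refine tendsto_finsetSum _ fun i _ => cmul hHs' i _ _ fun hi => ?_
      refine ContinuousAt.mul (cmul (by fun_prop) i _ _ fun hi' =>
        continuousAt_coord hv.continuousAt hi') ?_
      exact continuousAt_coord (continuousAt_symm (h := fun y' => h (H (s', y')))
        (by fun_prop) hi) hy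
    refine key.congr ?_
    filter_upwards [(h.continuous.comp hHs').continuousAt.preimage_mem_nhds
      ((trivializationAt ℂ L (h (H (s', y)))).open_baseSet.mem_nhds hy)] with y' hy'
    refine ((coord_sum hy' _ _).trans (Finset.sum_congr rfl fun i _ => ?_)).symm
    rw [coord_smul hy', mul_assoc]
    rfl
  have hLift : Lift 1 → Lift 0 := by
    refine PreconnectedSpace.induction₂' (fun s s' => Lift s → Lift s') (fun s => ?_)
      ⟨fun _ _ _ h₁ h₂ => h₂ ∘ h₁⟩ 1 0
    have h1 : ∀ᶠ s' in 𝓝 s, ∀ y ∈ (Set.univ : Set Y),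
        (∀ v : L (h (H (s, y))), v ≠ 0 → T (H (s', y)) (H (s, y)) v ≠ 0) ∧
        ∀ v : L (h (H (s', y))), v ≠ 0 → T (H (s, y)) (H (s', y)) v ≠ 0 := by
      refine isCompact_univ.eventually_forall_of_forall_eventually fun y _ => ?_
      have c1 : ContinuousAt (fun q : I × Y => (H q, H (s, q.2))) (s, y) := by fun_prop
      have c2 : ContinuousAt (fun q : I × Y => (H (s, q.2), H q)) (s, y) := by fun_prop
      exact (c1.eventually (hT (H (s, y)))).and (c2.eventually (hT (H (s, y))))
    filter_upwards [h1] with s' hs'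
    exact ⟨step _ _ fun y => (hs' y trivial).1, step _ _ fun y => (hs' y trivial).2⟩
  have hL1 : Lift 1 := by
    have hb : ∀ y, h (H (1, y)) ∈ (trivializationAt ℂ L (h y₁)).baseSet := fun y => by
      rw [H.apply_one]
      exact FiberBundle.mem_baseSet_trivializationAt' (F := ℂ) (E := L) (h y₁)
    refine ⟨fun y => (trivializationAt ℂ L (h y₁)).symm (h (H (1, y))) 1, fun y hy => ?_,
      continuous_iff_continuousAt.2 fun y => continuousAt_symm (by fun_prop) (hb y)⟩
    have h1 := coord_symm (L := L) (hb y) 1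
    rw [show (trivializationAt ℂ L (h y₁)).symm (h (H (1, y))) 1 = 0 from hy,
      (coord_eq_zero (hb y)).2 rfl] at h1
    exact zero_ne_one h1
  obtain ⟨v, hv0, hv⟩ := hLift hL1
  exact ⟨⟨fun y => ⟨⟨h (H (0, y)), v y⟩, hv0 y⟩, hv.subtype_mk _⟩, fun y => by simp⟩

/-- The quotient of two nonzero vectors of a fibre is continuous, since it is the quotient of their
coordinates in a trivialisation. -/
lemma exists_ratio_frames : ∃ δ : Frames L × Frames L → ℂˣ,
    ContinuousOn δ {q | q.1.1.proj = q.2.1.proj} ∧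
      ∀ q : Frames L × Frames L, q.1.1.proj = q.2.1.proj → δ q • q.1 = q.2 := by
  classical
  have ex : ∀ q : Frames L × Frames L, ∃ u : ℂˣ, q.1.1.proj = q.2.1.proj → u • q.1 = q.2 := by
    rintro ⟨⟨⟨x, v⟩, hv⟩, ⟨⟨y, w⟩, hw⟩⟩
    by_cases hxy : x = y
    · subst hxy
      obtain ⟨c, rfl⟩ := exists_smul_eq hv w
      exact ⟨Units.mk0 c fun hc => hw (by simp [hc]), fun _ => rfl⟩
    · exact ⟨1, fun h => (hxy h).elim⟩
  choose δ hδ using ex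
  refine ⟨δ, fun q₀ hq₀ => ?_, hδ⟩
  rw [Units.isEmbedding_val₀.continuousWithinAt_iff]
  let e := trivializationAt ℂ L q₀.1.1.proj
  have hb : q₀.1.1.proj ∈ e.baseSet := FiberBundle.mem_baseSet_trivializationAt' _
  have hb' : q₀.2.1.proj ∈ e.baseSet := hq₀ ▸ hb
  have c1 : ContinuousAt (fun q : Frames L × Frames L => (e q.1.1).2) q₀ :=
    continuousAt_coord (by fun_prop) hb
  have c2 : ContinuousAt (fun q : Frames L × Frames L => (e q.2.1).2) q₀ :=
    continuousAt_coord (by fun_prop) hb'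
  have hn : ∀ p : Frames L, p.1.proj ∈ e.baseSet → (e p.1).2 ≠ 0 := fun p hp =>
    (coord_eq_zero hp).not.2 p.2
  have hrat : ∀ q ∈ {q : Frames L × Frames L | q.1.1.proj = q.2.1.proj},
      q.1.1.proj ∈ e.baseSet → (δ q : ℂ) = (e q.2.1).2 / (e q.1.1).2 := by
    intro q hq hqb
    rw [eq_div_iff (hn _ hqb), ← coord_smul hqb]
    exact congrArg (fun p : Frames L => (e p.1).2) (hδ q hq)
  refine ((c2.div c1 (hn _ hb)).continuousWithinAt).congr_of_eventuallyEq ?_ (hrat q₀ hq₀ hb)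
  have hnear : ∀ᶠ q : Frames L × Frames L in 𝓝 q₀, q.1.1.proj ∈ e.baseSet :=
    ((FiberBundle.continuous_proj ℂ L).comp
      (continuous_subtype_val.comp continuous_fst)).continuousAt.preimage_mem_nhds
        (e.open_baseSet.mem_nhds hb)
  filter_upwards [self_mem_nhdsWithin, nhdsWithin_le_nhds hnear] with q hq hqb
  exact hrat q hq hqb

/-- The frames of a complex line bundle form a principal bundle. -/
lemma isPrincipal_frames : IsPrincipal (fun p : Frames L => p.1.proj) where
  continuous_proj := (FiberBundle.continuous_proj ℂ L).comp continuous_subtype_val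
  continuous_smul := by
    refine Continuous.subtype_mk (continuous_iff_continuousAt.2 fun q₀ => ?_) _
    have hb := FiberBundle.mem_baseSet_trivializationAt' (F := ℂ) (E := L) q₀.2.1.proj
    have hc : Continuous fun q : ℂˣ × Frames L => q.2.1.proj :=
      (FiberBundle.continuous_proj ℂ L).comp (continuous_subtype_val.comp continuous_snd)
    refine (FiberBundle.continuousAt_totalSpace ℂ _).2 ⟨hc.continuousAt, ?_⟩
    have key : ContinuousAt (fun q : ℂˣ × Frames L =>
        (q.1 : ℂ) * (trivializationAt ℂ L q₀.2.1.proj q.2.1).2) q₀ :=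
      (Units.continuous_val.comp continuous_fst).continuousAt.mul
        (continuousAt_coord (by fun_prop) hb)
    refine key.congr ?_
    filter_upwards [hc.continuousAt.preimage_mem_nhds
      ((trivializationAt ℂ L q₀.2.1.proj).open_baseSet.mem_nhds hb)] with q hq
    exact (coord_smul hq _ _).symm
  proj_smul _ _ := rfl
  free := by
    rintro u ⟨⟨x, v⟩, hv⟩ h
    have h1 : (u : ℂ) • v = v := by
      have := congrArg Subtype.val h
      rw [coe_smul_frame] at this
      simpa using this
    have h2 : ((u : ℂ) - 1) • v = 0 := by rw [sub_smul, h1, one_smul, sub_self]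
    exact Units.ext (sub_eq_zero.1 ((smul_eq_zero.1 h2).resolve_right hv))
  exists_ratio := exists_ratio_frames
  exists_lift Y _ _ _ _ h := exists_lift_frames Y h

end Frame

/-! ### Smooth functions and sections -/

section Smooth

open Filter

variable {E : Type*} [NormedAddCommGroup E] [NormedSpace ℝ E]
  {H : Type*} [TopologicalSpace H] {I : ModelWithCorners ℝ E H}
  {M : Type*} [TopologicalSpace M] [ChartedSpace H M]

/-- Every point of a manifold, possibly with boundary and corners, has a basis of simply connected
open neighbourhoods: the convex sets in the range of the model which are cut out by balls. -/
lemma exists_isSimplyConnected_nhd (I : ModelWithCorners ℝ E H) (x : M) (U : Set M) (hU : U ∈ 𝓝 x) :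
    ∃ V ⊆ U, x ∈ V ∧ IsOpen V ∧ IsSimplyConnected V := by
  let φ := extChartAt I x
  have h1 : φ.symm ⁻¹' U ∩ φ.target ∈ 𝓝[Set.range I] (φ x) := by
    refine inter_mem ?_ (extChartAt_target_mem_nhdsWithin x)
    have := (continuousAt_extChartAt_symm (I := I) x)
    exact nhdsWithin_le_nhds (this.preimage_mem_nhds (by rwa [extChartAt_to_inv]))
  obtain ⟨r, hr, hrU⟩ := Metric.mem_nhdsWithin_iff.1 h1
  let S := Metric.ball (φ x) r ∩ Set.range I
  have hS : Convex ℝ S := (convex_ball _ _).inter I.convex_range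
  have hxS : φ x ∈ S := ⟨Metric.mem_ball_self hr, ⟨_, rfl⟩⟩
  let V := φ.source ∩ φ ⁻¹' Metric.ball (φ x) r
  have hVS : ∀ y ∈ V, φ y ∈ S := fun y hy => ⟨hy.2, ⟨_, rfl⟩⟩
  have hSV : ∀ z ∈ S, φ.symm z ∈ V := fun z hz =>
    ⟨φ.map_target (hrU hz).2, by rw [Set.mem_preimage, φ.right_inv (hrU hz).2]; exact hz.1⟩
  let e : V ≃ₜ S :=
    { toFun := fun y => ⟨φ y, hVS y y.2⟩
      invFun := fun z => ⟨φ.symm z, hSV z z.2⟩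
      left_inv := fun y => Subtype.ext (φ.left_inv y.2.1)
      right_inv := fun z => Subtype.ext (φ.right_inv (hrU z.2).2)
      continuous_toFun := Continuous.subtype_mk (ContinuousOn.comp_continuous
        (continuousOn_extChartAt x) continuous_subtype_val fun y => y.2.1) _
      continuous_invFun := Continuous.subtype_mk (ContinuousOn.comp_continuous
        (continuousOn_extChartAt_symm x) continuous_subtype_val fun z => (hrU z.2).2) _ }
  refine ⟨V, fun y hy => ?_, ⟨mem_extChartAt_source x, Metric.mem_ball_self hr⟩,
    (continuousOn_extChartAt x).isOpen_inter_preimage (isOpen_extChartAt_source x)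
      Metric.isOpen_ball, ?_⟩
  · have := (hrU (hVS y hy)).1
    rwa [Set.mem_preimage, φ.left_inv hy.1] at this
  · have := hS.contractibleSpace ⟨_, hxS⟩
    have := e.contractibleSpace
    exact SimplyConnectedSpace.ofContractible V

lemma locallyPathConnectedSpace_of_model (I : ModelWithCorners ℝ E H) :
    LocallyPathConnectedSpace M where
  path_connected_basis x := by
    refine hasBasis_self.2 fun U hU => ?_
    obtain ⟨V, hVU, hxV, hVo, hV⟩ := exists_isSimplyConnected_nhd I x U hU
    exact ⟨V, hVo.mem_nhds hxV, hV.isPathConnected, hVU⟩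

lemma _root_.ContMDiffAt.complex_mul {f g : M → ℂ} {x : M} (hf : ContMDiffAt I 𝓘(ℝ, ℂ) ∞ f x)
    (hg : ContMDiffAt I 𝓘(ℝ, ℂ) ∞ g x) : ContMDiffAt I 𝓘(ℝ, ℂ) ∞ (fun y => f y * g y) x :=
  (contDiff_mul (𝕜 := ℝ) (𝔸 := ℂ)).contMDiff.contMDiffAt.comp x (hf.prodMk_space hg)

lemma _root_.ContMDiffAt.complex_inv {f : M → ℂ} {x : M} (hf : ContMDiffAt I 𝓘(ℝ, ℂ) ∞ f x)
    (h0 : f x ≠ 0) : ContMDiffAt I 𝓘(ℝ, ℂ) ∞ (fun y => (f y)⁻¹) x :=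
  (contDiffAt_inv ℝ h0).contMDiffAt.comp x hf

lemma _root_.ContMDiffAt.complex_exp {f : M → ℂ} {x : M} (hf : ContMDiffAt I 𝓘(ℝ, ℂ) ∞ f x) :
    ContMDiffAt I 𝓘(ℝ, ℂ) ∞ (fun y => Complex.exp (f y)) x :=
  (Complex.contDiff_exp (𝕜 := ℝ)).contMDiff.contMDiffAt.comp x hf

/-- A continuous logarithm of a smooth function is smooth: it is locally given by the principal
branch. -/
lemma contMDiffAt_of_exp {h f : M → ℂ} {x : M} (hh : ContinuousAt h x)
    (hf : ContMDiffAt I 𝓘(ℝ, ℂ) ∞ f x) (hfh : ∀ᶠ y in 𝓝 x, Complex.exp (h y) = f y) :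
    ContMDiffAt I 𝓘(ℝ, ℂ) ∞ h x := by
  have h1 : ContMDiffAt I 𝓘(ℝ, ℂ) ∞ (fun y => f y * Complex.exp (-h x)) x :=
    hf.complex_mul contMDiffAt_const
  have h2 : f x * Complex.exp (-h x) = 1 := by
    rw [← hfh.self_of_nhds, ← Complex.exp_add, add_neg_cancel, Complex.exp_zero]
  have h3 : ContDiffAt ℝ ∞ Complex.log (f x * Complex.exp (-h x)) :=
    (Complex.contDiffAt_log (by simp [h2])).restrict_scalars ℝ
  have h4 : ContMDiffAt I 𝓘(ℝ, ℂ) ∞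
      (fun y => h x + Complex.log (f y * Complex.exp (-h x))) x :=
    contMDiffAt_const.add (h3.contMDiffAt.comp x h1)
  refine h4.congr_of_eventuallyEq ?_
  have h5 : ∀ᶠ y in 𝓝 x, h y ∈ Metric.ball (h x) Real.pi :=
    hh.preimage_mem_nhds (Metric.ball_mem_nhds _ Real.pi_pos)
  filter_upwards [hfh, h5] with y hy hy'
  have h6 : |(h y - h x).im| < Real.pi :=
    (Complex.abs_im_le_norm _).trans_lt (by rwa [← dist_eq_norm])
  rw [← hy, ← Complex.exp_add, ← sub_eq_add_neg,
    Complex.log_exp (abs_lt.1 h6).1 (abs_lt.1 h6).2.le]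
  ring

variable {L : M → Type*} [∀ m, NormedAddCommGroup (L m)] [∀ m, InnerProductSpace ℂ (L m)]
  [TopologicalSpace (TotalSpace ℂ L)] [FiberBundle ℂ L] [VectorBundle ℂ ℂ L]
  {E' : Type*} [NormedAddCommGroup E'] [NormedSpace ℝ E']
  {H' : Type*} [TopologicalSpace H'] {I' : ModelWithCorners ℝ E' H'}
  {N : Type*} [TopologicalSpace N] [ChartedSpace H' N]

lemma contMDiffAt_smul {b : N → M} {v : ∀ n, L (b n)} {g : N → ℂ} {n : N}
    (hv : ContMDiffAt I' (I.prod 𝓘(ℝ, ℂ)) ∞ (fun n => TotalSpace.mk' ℂ (b n) (v n)) n)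
    (hg : ContMDiffAt I' 𝓘(ℝ, ℂ) ∞ g n) :
    ContMDiffAt I' (I.prod 𝓘(ℝ, ℂ)) ∞ (fun n => TotalSpace.mk' ℂ (b n) (g n • v n)) n := by
  have h1 := contMDiffAt_totalSpace.1 hv
  refine contMDiffAt_totalSpace.2 ⟨h1.1, (hg.complex_mul h1.2).congr_of_eventuallyEq ?_⟩
  filter_upwards [h1.1.continuousAt.preimage_mem_nhds
    ((trivializationAt ℂ L (b n)).open_baseSet.mem_nhds
      (FiberBundle.mem_baseSet_trivializationAt' _))] with n' hn'
  exact coord_smul hn' _ _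

/-- The quotient of a smooth section of a line bundle by a nonvanishing one is smooth. -/
lemma contMDiffAt_of_smul_eq {b : N → M} {v w : ∀ n, L (b n)} {g : N → ℂ} {n : N}
    (hv : ContMDiffAt I' (I.prod 𝓘(ℝ, ℂ)) ∞ (fun n => TotalSpace.mk' ℂ (b n) (v n)) n)
    (hw : ContMDiffAt I' (I.prod 𝓘(ℝ, ℂ)) ∞ (fun n => TotalSpace.mk' ℂ (b n) (w n)) n)
    (h0 : ∀ᶠ n' in 𝓝 n, w n' ≠ 0) (hg : ∀ᶠ n' in 𝓝 n, g n' • w n' = v n') :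
    ContMDiffAt I' 𝓘(ℝ, ℂ) ∞ g n := by
  have h1 := contMDiffAt_totalSpace.1 hv
  have h2 := contMDiffAt_totalSpace.1 hw
  have hb : b n ∈ (trivializationAt ℂ L (b n)).baseSet :=
    FiberBundle.mem_baseSet_trivializationAt' _
  refine (h1.2.complex_mul (h2.2.complex_inv
    ((coord_eq_zero hb).not.2 h0.self_of_nhds))).congr_of_eventuallyEq ?_
  filter_upwards [h0, hg, h1.1.continuousAt.preimage_mem_nhds
    ((trivializationAt ℂ L (b n)).open_baseSet.mem_nhds hb)] with n' h0' hg' hn'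
  have hn'' : b n' ∈ (trivializationAt ℂ L (b n)).baseSet := hn'
  change g n' = (trivializationAt ℂ L (b n) ⟨b n', v n'⟩).2 *
    (trivializationAt ℂ L (b n) ⟨b n', w n'⟩).2⁻¹
  rw [← hg', coord_smul hn'', mul_inv_cancel_right₀ ((coord_eq_zero hn'').not.2 h0')]

variable [VectorBundle ℝ ℂ L] [ContMDiffVectorBundle ∞ ℂ L I]

omit [VectorBundle ℂ ℂ L] in
lemma contMDiffAt_symm_section {x₀ y : M} (hy : y ∈ (trivializationAt ℂ L x₀).baseSet) :
    ContMDiffAt I (I.prod 𝓘(ℝ, ℂ)) ∞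
      (fun y => TotalSpace.mk' ℂ y ((trivializationAt ℂ L x₀).symm y 1)) y := by
  have h1 := ((trivializationAt ℂ L x₀).contMDiffOn_symm (IB := I) (n := ∞)).contMDiffAt
    (x := (y, (1 : ℂ))) (((trivializationAt ℂ L x₀).open_target).mem_nhds
      ((trivializationAt ℂ L x₀).mem_target.2 hy))
  have h2 : ContMDiffAt I (I.prod 𝓘(ℝ, ℂ)) ∞ (fun y : M => (y, (1 : ℂ))) y :=
    contMDiffAt_id.prodMk contMDiffAt_const
  refine (h1.comp y h2).congr_of_eventuallyEq ?_
  filter_upwards [(trivializationAt ℂ L x₀).open_baseSet.mem_nhds hy] with z hz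
  exact (trivializationAt ℂ L x₀).mk_symm hz 1

end Smooth

/-! ### A global frame -/

section Global
open Filter

variable {E : Type*} [NormedAddCommGroup E] [NormedSpace ℝ E]
  {H : Type*} [TopologicalSpace H] {I : ModelWithCorners ℝ E H}
  {M : Type*} [TopologicalSpace M] [ChartedSpace H M]
  {L : M → Type*} [∀ m, NormedAddCommGroup (L m)] [∀ m, InnerProductSpace ℂ (L m)]
  [TopologicalSpace (TotalSpace ℂ L)] [FiberBundle ℂ L] [VectorBundle ℂ ℂ L]
  [VectorBundle ℝ ℂ L] [ContMDiffVectorBundle ∞ ℂ L I]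

variable (L) in
/-- A complex line bundle over a 2-connected manifold has a nowhere vanishing smooth section.
Local sections differ by the exponential of a smooth additive cocycle, which is a coboundary by
means of a partition of unity. -/
theorem exists_smooth_frame [FiniteDimensional ℝ E] [IsManifold I ∞ M] [T2Space M]
    [SigmaCompactSpace M] (hM : IsTwoConnected M) :
    ∃ σ : ∀ m, L m, (∀ m, σ m ≠ 0) ∧
      ContMDiff I (I.prod 𝓘(ℝ, ℂ)) ∞ (fun m => TotalSpace.mk' ℂ m (σ m)) := by
  have := locallyPathConnectedSpace_of_model (M := M) I
  choose W hWb hxW hWo hW using fun x : M => exists_isSimplyConnected_nhd I x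
    (trivializationAt ℂ L x).baseSet ((trivializationAt ℂ L x).open_baseSet.mem_nhds
      (FiberBundle.mem_baseSet_trivializationAt' _))
  let t : ∀ x y, L y := fun x y => (trivializationAt ℂ L x).symm y 1
  have ht0 : ∀ x, ∀ y ∈ W x, t x y ≠ 0 := fun x y hy h => by
    have h1 := coord_symm (hWb x hy) 1
    rw [show (trivializationAt ℂ L x).symm y 1 = 0 from h, (coord_eq_zero (hWb x hy)).2 rfl] at h1
    exact zero_ne_one h1
  have hts : ∀ x, ∀ y ∈ W x, ContMDiffAt I (I.prod 𝓘(ℝ, ℂ)) ∞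
      (fun y => TotalSpace.mk' ℂ y (t x y)) y := fun x y hy =>
    contMDiffAt_symm_section (hWb x hy)
  let s : ∀ x, C(W x, Frames L) := fun x => ⟨fun y => ⟨⟨y, t x y⟩, ht0 x y y.2⟩,
    Continuous.subtype_mk (continuous_iff_continuousAt.2 fun y =>
      continuousAt_symm continuous_subtype_val.continuousAt (hWb x y.2)) _⟩
  obtain ⟨a, ha, hexp, hco⟩ := isPrincipal_frames.exists_log_cocycle hM
    (exists_isSimplyConnected_nhd I) W hWo hW s (fun _ _ => rfl)
  replace hexp : ∀ i j y, y ∈ W i → y ∈ W j → Complex.exp (a i j y) • t i y = t j y := by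
    intro i j y hi hj
    have := congrArg Subtype.val (hexp i j y hi hj)
    exact eq_of_heq (TotalSpace.mk.inj this).2
  have hsm : ∀ i j y, y ∈ W i → y ∈ W j → ContMDiffAt I 𝓘(ℝ, ℂ) ∞ (a i j) y := by
    intro i j y hi hj
    have hij : W i ∩ W j ∈ 𝓝 y := ((hWo i).inter (hWo j)).mem_nhds ⟨hi, hj⟩
    refine contMDiffAt_of_exp ((ha i j).continuousAt hij)
      (f := fun y => Complex.exp (a i j y)) ?_ (Eventually.of_forall fun _ => rfl)
    refine contMDiffAt_of_smul_eq (hts j y hj) (hts i y hi) ?_ ?_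
    · filter_upwards [hij] with y' hy'
      exact ht0 i y' hy'.1
    · filter_upwards [hij] with y' hy'
      exact hexp i j y' hy'.1 hy'.2
  obtain ⟨l, hl⟩ := SmoothPartitionOfUnity.exists_isSubordinate I isClosed_univ W hWo
    (fun x _ => Set.mem_iUnion.2 ⟨x, hxW x⟩)
  have hlW : ∀ i y, l i y ≠ 0 → y ∈ W i := fun i y hy =>
    hl i (subset_tsupport _ (Function.mem_support.2 hy))
  have hfin : ∀ y, (Function.support fun i => l i y).Finite := fun y =>
    l.locallyFinite.point_finite y
  -- the local frames `exp (∑ i, l i * a x i) t x` do not depend on `x`, by the cocycle condition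
  have key : ∀ x, ∀ y ∈ W x, Complex.exp (∑ᶠ i, l i y • a y i y) • t y y =
      Complex.exp (∑ᶠ i, l i y • a x i y) • t x y := by
    intro x y hy
    have h1 : ∑ᶠ i, l i y • a x i y = ∑ᶠ i, (l i y • a x y y + l i y • a y i y) := by
      refine finsum_congr fun i => ?_
      by_cases hi : l i y = 0
      · simp [hi]
      · rw [← smul_add, hco x y i y hy (hxW y) (hlW i y hi)]
    have h2 : ∑ᶠ i, l i y • a x y y = a x y y := by
      rw [← finsum_smul, l.sum_eq_one (Set.mem_univ y), one_smul]
    rw [h1, finsum_add_distrib ((hfin y).subset fun i hi h => hi (by simp [h]))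
      ((hfin y).subset fun i hi h => hi (by simp [h])), h2, add_comm, Complex.exp_add, mul_smul,
      hexp x y y hy (hxW y)]
  refine ⟨fun y => Complex.exp (∑ᶠ i, l i y • a y i y) • t y y, fun y =>
    smul_ne_zero (Complex.exp_ne_zero _) (ht0 y y (hxW y)), fun x => ?_⟩
  have h1 : ContMDiffAt I 𝓘(ℝ, ℂ) ∞ (fun y => ∑ᶠ i, l i y • a x i y) x :=
    l.contMDiffAt_finsum fun i hi => hsm x i x (hxW x) (hl i hi)
  refine (contMDiffAt_smul (hts x x (hxW x)) h1.complex_exp).congr_of_eventuallyEq ?_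
  filter_upwards [(hWo x).mem_nhds (hxW x)] with y hy
  rw [key x y hy]

end Global

/-! ### Unit frames on which the group acts by a character -/

section Equivariant
open Filter

variable {E : Type*} [NormedAddCommGroup E] [NormedSpace ℝ E]
  {H : Type*} [TopologicalSpace H] {I : ModelWithCorners ℝ E H}
  {M : Type*} [TopologicalSpace M] [ChartedSpace H M]
  {L : M → Type*} [∀ m, NormedAddCommGroup (L m)] [∀ m, InnerProductSpace ℂ (L m)]
  [TopologicalSpace (TotalSpace ℂ L)] [FiberBundle ℂ L] [VectorBundle ℝ ℂ L]

lemma contMDiff_inner [hL : IsHermitianLineBundle I L] {σ τ : ∀ m, L m}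
    (hσ : ContMDiff I (I.prod 𝓘(ℝ, ℂ)) ∞ (fun m => TotalSpace.mk' ℂ m (σ m)))
    (hτ : ContMDiff I (I.prod 𝓘(ℝ, ℂ)) ∞ (fun m => TotalSpace.mk' ℂ m (τ m))) :
    ContMDiff I 𝓘(ℝ, ℂ) ∞ (fun m => inner ℂ (σ m) (τ m)) := by
  obtain ⟨g, hg, hgi⟩ := hL.contMDiffMetric
  have h1 := hg.clm_bundle_apply₂ (F₃ := ℂ) (E₃ := Bundle.Trivial M ℂ) hσ hτ
  intro m
  refine ((contMDiffAt_section m).1 (h1 m)).congr_of_eventuallyEq ?_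
  exact Eventually.of_forall fun m' => hgi m' _ _

/-- A hermitian line bundle over a 2-connected manifold has a smooth section of length one. -/
lemma exists_smooth_unit_frame [FiniteDimensional ℝ E] [IsManifold I ∞ M] [T2Space M]
    [SigmaCompactSpace M] [hL : IsHermitianLineBundle I L] (hM : IsTwoConnected M) :
    ∃ σ : ∀ m, L m, (∀ m, ‖σ m‖ = 1) ∧
      ContMDiff I (I.prod 𝓘(ℝ, ℂ)) ∞ (fun m => TotalSpace.mk' ℂ m (σ m)) := by
  have := hL.vectorBundle_complex
  have := hL.contMDiffVectorBundle
  obtain ⟨σ, hσ0, hσ⟩ := exists_smooth_frame (I := I) L hM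
  have h0 : ∀ m, ‖σ m‖ ≠ 0 := fun m => norm_ne_zero_iff.2 (hσ0 m)
  refine ⟨fun m => ((‖σ m‖⁻¹ : ℝ) : ℂ) • σ m, fun m => ?_, fun m => ?_⟩
  · rw [norm_smul, Complex.norm_real, norm_inv, norm_norm, inv_mul_cancel₀ (h0 m)]
  refine contMDiffAt_smul (hσ m) ?_
  have h1 : ContDiffAt ℝ ∞ (fun z : ℂ => (((Real.sqrt z.re)⁻¹ : ℝ) : ℂ))
      (inner ℂ (σ m) (σ m)) := by
    have hre : (inner ℂ (σ m) (σ m)).re = ‖σ m‖ ^ 2 := by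
      rw [inner_self_eq_norm_sq_to_K]; norm_cast
    have hpos : 0 < (inner ℂ (σ m) (σ m)).re := by
      rw [hre]; exact pow_pos (norm_pos_iff.2 (hσ0 m)) 2
    exact Complex.ofRealCLM.contDiff.contDiffAt.comp _
      ((Complex.reCLM.contDiff.contDiffAt.sqrt hpos.ne').inv (Real.sqrt_pos.2 hpos).ne')
  refine (h1.contMDiffAt.comp m (contMDiff_inner hσ hσ m)).congr_of_eventuallyEq
    (Eventually.of_forall fun m' => ?_)
  have : (inner ℂ (σ m') (σ m')).re = ‖σ m'‖ ^ 2 := by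
    rw [inner_self_eq_norm_sq_to_K]; norm_cast
  simp only [Function.comp_apply, this, Real.sqrt_sq (norm_nonneg _)]

variable [IsManifold I ∞ M] [MulAction ℤˣ M] {nabla : UnitaryConnection I L}

/-- The action of `ζ` on the total space. -/
def EquivariantStructure.onTotalSpace (ρ : EquivariantStructure nabla) (ζ : ℤˣ)
    (p : TotalSpace ℂ L) : TotalSpace ℂ L := ⟨ζ • p.proj, ρ.toFun ζ p.proj p.snd⟩

lemma EquivariantStructure.onTotalSpace_mul (ρ : EquivariantStructure nabla) (ζ ξ : ℤˣ)
    (p : TotalSpace ℂ L) :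
    ρ.onTotalSpace ζ (ρ.onTotalSpace ξ p) = ρ.onTotalSpace (ζ * ξ) p :=
  ρ.map_mul ζ ξ p.proj p.snd

/-- The neutral element acts trivially, since it acts by an injective idempotent map. -/
lemma EquivariantStructure.onTotalSpace_one (ρ : EquivariantStructure nabla)
    (p : TotalSpace ℂ L) : ρ.onTotalSpace 1 p = p := by
  have h1 : ρ.onTotalSpace 1 (ρ.onTotalSpace 1 p) = ρ.onTotalSpace 1 p := by
    rw [ρ.onTotalSpace_mul, mul_one]
  have inj : ∀ p q, ρ.onTotalSpace 1 p = ρ.onTotalSpace 1 q → p = q := by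
    rintro ⟨x, v⟩ ⟨y, w⟩ h
    have hxy : x = y := by simpa [onTotalSpace] using congrArg TotalSpace.proj h
    subst hxy
    exact congrArg _ ((ρ.toFun 1 x).injective (TotalSpace.mk_inj.1 h))
  exact inj _ _ h1

/-- A 2-connected base admits a smooth unit frame on which the group acts by a character. If the
generator sends the unit frame `σ` to `f σ` and `f = exp h`, then the sum of `h` and its translate
is constant, since its exponential is one, and `exp (-h / 2) σ` has the required property. -/
theorem exists_equivariant_frame [FiniteDimensional ℝ E] [T2Space M] [SigmaCompactSpace M]
    [IsSmoothAction I M] [hL : IsHermitianLineBundle I L] (hM : IsTwoConnected M)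
    (ρ : EquivariantStructure nabla) :
    ∃ (σ : ∀ m, L m) (s : ℤˣ), (∀ m, ‖σ m‖ = 1) ∧
      ContMDiff I (I.prod 𝓘(ℝ, ℂ)) ∞ (fun m => TotalSpace.mk' ℂ m (σ m)) ∧
      ∀ ζ m, ρ.toFun ζ m (σ m) = character s ζ • σ (ζ • m) := by
  have := hL.vectorBundle_complex
  obtain ⟨σ, hσ1, hσ⟩ := exists_smooth_unit_frame (I := I) (L := L) hM
  have hσ0 : ∀ m, σ m ≠ 0 := fun m h => by simpa [h] using hσ1 m
  have hone : ∀ m, ρ.toFun 1 m (σ m) = σ ((1 : ℤˣ) • m) := fun m => by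
    have h1 := ρ.onTotalSpace_one ⟨m, σ m⟩
    have h2 : (⟨(1 : ℤˣ) • m, σ ((1 : ℤˣ) • m)⟩ : TotalSpace ℂ L) = ⟨m, σ m⟩ := by rw [one_smul]
    exact TotalSpace.mk_inj.1 (h1.trans h2.symm)
  choose f hf using fun m => exists_smul_eq (hσ0 ((-1 : ℤˣ) • m)) (ρ.toFun (-1) m (σ m))
  have hact : ContMDiff I I ∞ (fun m : M => (-1 : ℤˣ) • m) := IsSmoothAction.contMDiff_smul (-1)
  have hfs : ContMDiff I 𝓘(ℝ, ℂ) ∞ f := fun m => contMDiffAt_of_smul_eq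
    (b := fun m => (-1 : ℤˣ) • m) (((ρ.smooth (-1)).comp hσ) m) ((hσ.comp hact) m)
    (Eventually.of_forall fun m => hσ0 _) (Eventually.of_forall hf)
  have hf1 : ∀ m, ‖f m‖ = 1 := fun m => by
    have := congrArg norm (hf m)
    rwa [norm_smul, hσ1, mul_one, LinearIsometryEquiv.norm_map, hσ1] at this
  have hff : ∀ m, f m * f ((-1 : ℤˣ) • m) = 1 := by
    intro m
    have h1 : ∀ c x, ρ.onTotalSpace (-1) ⟨x, c • σ x⟩ =
        ⟨(-1 : ℤˣ) • x, (c * f x) • σ ((-1 : ℤˣ) • x)⟩ := fun c x =>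
      TotalSpace.mk_inj.2 (by rw [map_smul, ← hf, smul_smul])
    have h2 := ρ.onTotalSpace_mul (-1) (-1) ⟨m, (1 : ℂ) • σ m⟩
    have h3 : (⟨(-1 : ℤˣ) • (-1 : ℤˣ) • m, (f m * f ((-1 : ℤˣ) • m)) •
        σ ((-1 : ℤˣ) • (-1 : ℤˣ) • m)⟩ : TotalSpace ℂ L) = ⟨m, σ m⟩ := by
      rwa [h1, h1, one_mul, show (-1 : ℤˣ) * -1 = 1 from rfl, ρ.onTotalSpace_one, one_smul] at h2
    have h4 : (-1 : ℤˣ) • (-1 : ℤˣ) • m = m := congrArg TotalSpace.proj h3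
    rw [h4] at h3
    have h5 := TotalSpace.mk_inj.1 h3
    exact smul_left_injective ℂ (hσ0 m) (h5.trans (one_smul ℂ (σ m)).symm)
  have hM1 := hM.1
  have := locallyPathConnectedSpace_of_model (M := M) I
  obtain ⟨m₀⟩ : Nonempty M := inferInstance
  have hf0 : ∀ m, f m ≠ 0 := fun m => norm_ne_zero_iff.1 (by simp [hf1])
  obtain ⟨h, -, hh⟩ := exists_continuous_log (⟨fun m => Units.mk0 (f m) (hf0 m),
    Units.isEmbedding_val₀.continuous_iff.2 hfs.continuous⟩ : C(M, ℂˣ)) m₀ (Complex.log (f m₀))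
    (Units.ext (Complex.exp_log (hf0 m₀)))
  replace hh : ∀ m, Complex.exp (h m) = f m := fun m => congrArg Units.val (hh m)
  have hhs : ContMDiff I 𝓘(ℝ, ℂ) ∞ h := fun m => contMDiffAt_of_exp h.continuous.continuousAt
    (hfs m) (Eventually.of_forall hh)
  have hre : ∀ m, (h m).re = 0 := fun m => by
    have h1 := hf1 m
    rwa [← hh, Complex.norm_exp, Real.exp_eq_one_iff] at h1
  have hconst : ∀ m, h m + h ((-1 : ℤˣ) • m) = h m₀ + h ((-1 : ℤˣ) • m₀) := fun m =>
    log_const (f := fun m => h m + h ((-1 : ℤˣ) • m)) (c := 1)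
      (h.continuous.add (h.continuous.comp hact.continuous)) (fun m => Units.ext (by
        simp [Complex.exp_add, hh, hff])) m m₀
  let ε := Complex.exp ((h m₀ + h ((-1 : ℤˣ) • m₀)) / 2)
  have hε : ε * ε = 1 := by
    rw [← Complex.exp_add, add_halves, Complex.exp_add, hh, hh, hff]
  obtain ⟨s, hs⟩ : ∃ s : ℤˣ, character s (-1) = ε := by
    rcases mul_self_eq_one_iff.1 hε with h1 | h1
    · exact ⟨1, by simp [character, h1]⟩
    · exact ⟨-1, by simp [character, eps, h1]⟩
  refine ⟨fun m => Complex.exp (-(h m) / 2) • σ m, s, fun m => ?_, fun m => ?_, fun ζ m => ?_⟩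
  · rw [norm_smul, hσ1, Complex.norm_exp]
    simp [hre]
  · refine contMDiffAt_smul (hσ m) (ContMDiffAt.complex_exp ?_)
    exact ((hhs m).complex_mul (contMDiffAt_const (c := -(1 / 2 : ℂ)))).congr_of_eventuallyEq
      (Eventually.of_forall fun m => by ring)
  · rcases Int.units_eq_one_or ζ with rfl | rfl
    · rw [map_smul, hone]
      simp [character, eps]
    · rw [map_smul, ← hf, hs, smul_smul, smul_smul]
      congr 1
      rw [← hh, ← Complex.exp_add, ← Complex.exp_add, ← hconst m]
      congr 1
      ring

end Equivariant

/-! ### The connection form and the isomorphism with the trivial bundle -/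

section ConnectionForm
open Filter

variable {E : Type*} [NormedAddCommGroup E] [NormedSpace ℝ E]
  {H : Type*} [TopologicalSpace H] {I : ModelWithCorners ℝ E H}
  {M : Type*} [TopologicalSpace M] [ChartedSpace H M]
  {L : M → Type*} [∀ m, NormedAddCommGroup (L m)] [∀ m, InnerProductSpace ℂ (L m)]
  [TopologicalSpace (TotalSpace ℂ L)] [FiberBundle ℂ L] [VectorBundle ℝ ℂ L]

lemma inner_smul_of_norm_eq_one {V : Type*} [NormedAddCommGroup V] [InnerProductSpace ℂ V]
    {v : V} (hv : ‖v‖ = 1) (c : ℂ) : inner ℂ v (c • v) = c := by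
  rw [inner_smul_right, inner_self_eq_norm_sq_to_K, hv]
  simp

lemma inner_smul_frame [hL : IsHermitianLineBundle I L] {m : M} {e : L m} (he : ‖e‖ = 1)
    (v : L m) : (inner ℂ e v : ℂ) • e = v := by
  have := hL.vectorBundle_complex
  obtain ⟨c, rfl⟩ := exists_smul_eq (v := e) (fun h => by simp [h] at he) v
  rw [inner_smul_of_norm_eq_one he]

/-- The coordinate of a differentiable section with respect to a smooth unit frame, that is, its
quotient by the frame, is differentiable. -/
lemma mdifferentiableAt_inner_frame [hL : IsHermitianLineBundle I L] {σ τ : ∀ m, L m}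
    (hσ1 : ∀ m, ‖σ m‖ = 1)
    (hσ : ContMDiff I (I.prod 𝓘(ℝ, ℂ)) ∞ (fun m => TotalSpace.mk' ℂ m (σ m))) {m : M}
    (hτ : MDifferentiableAt I (I.prod 𝓘(ℝ, ℂ)) (fun m => TotalSpace.mk' ℂ m (τ m)) m) :
    MDifferentiableAt I 𝓘(ℝ, ℂ) (fun m => (inner ℂ (σ m) (τ m) : ℂ)) m := by
  have := hL.vectorBundle_complex
  have hb : m ∈ (trivializationAt ℂ L m).baseSet := FiberBundle.mem_baseSet_trivializationAt' _
  have h0 : ∀ m, σ m ≠ 0 := fun m h => by simpa [h] using hσ1 m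
  have h1 := (mdifferentiableAt_section I τ).1 hτ
  have h2 := (((contMDiffAt_section m).1 (hσ m)).complex_inv
    ((coord_eq_zero hb).not.2 (h0 m))).mdifferentiableAt (by simp)
  refine (h1.mul h2).congr_of_eventuallyEq ?_
  filter_upwards [(trivializationAt ℂ L m).open_baseSet.mem_nhds hb] with m' hm'
  change _ = (trivializationAt ℂ L m ⟨m', τ m'⟩).2 * (trivializationAt ℂ L m ⟨m', σ m'⟩).2⁻¹
  rw [eq_mul_inv_iff_mul_eq₀ ((coord_eq_zero hm').not.2 (h0 m')), ← coord_smul hm',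
    inner_smul_frame (I := I) (hσ1 m')]

variable [IsManifold I ∞ M] {nabla : UnitaryConnection I L}

/-- The connection form `A = i ⟨σ, ∇ σ⟩` of a frame `σ`. -/
def connectionForm (nabla : UnitaryConnection I L) (σ : ∀ m, L m) (m : M) :
    TangentSpace I m →L[ℝ] ℝ :=
  Complex.reCLM.comp ((ContinuousLinearMap.mul ℝ ℂ Complex.I).comp
    (((innerSL ℂ (σ m)).restrictScalars ℝ).comp (nabla.toFun σ m)))

lemma connectionForm_apply (σ : ∀ m, L m) (m : M) (v : TangentSpace I m) :
    connectionForm nabla σ m v = (Complex.I * inner ℂ (σ m) (nabla.toFun σ m v)).re := rfl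

/-- The covariant derivative of a unit frame, in terms of the connection form. -/
lemma inner_nabla [IsHermitianLineBundle I L] {σ : ∀ m, L m} (hσ1 : ∀ m, ‖σ m‖ = 1)
    (hσ : ContMDiff I (I.prod 𝓘(ℝ, ℂ)) ∞ (fun m => TotalSpace.mk' ℂ m (σ m))) (m : M)
    (v : TangentSpace I m) : inner ℂ (σ m) (nabla.toFun σ m v) =
      1 / Complex.I * connectionForm nabla σ m v := by
  have hd : MDifferentiableAt I (I.prod 𝓘(ℝ, ℂ)) (fun m => TotalSpace.mk' ℂ m (σ m)) m :=
    (hσ m).mdifferentiableAt (by simp)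
  have h1 := nabla.metric σ σ m hd hd v
  have h2 : (fun m => inner ℂ (σ m) (σ m)) = fun _ : M => (1 : ℂ) := by
    funext m
    simpa using inner_smul_of_norm_eq_one (hσ1 m) 1
  rw [h2, mvfderiv_const, ← inner_conj_symm (nabla.toFun σ m v)] at h1
  have h3 : (inner ℂ (σ m) (nabla.toFun σ m v)).re = 0 := by
    have := congrArg Complex.re h1
    simp only [zero_apply, Complex.zero_re, Complex.add_re, Complex.conj_re] at this
    linarith
  rw [connectionForm_apply]
  apply Complex.ext <;> simp [h3]

/-- The connection form of a smooth frame is smooth: in trivialisations it is a composition of the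
smooth families of linear maps given by the metric and by the covariant derivative. -/
lemma contMDiff_connectionForm [hL : IsHermitianLineBundle I L] {σ : ∀ m, L m}
    (hσ : ContMDiff I (I.prod 𝓘(ℝ, ℂ)) ∞ (fun m => TotalSpace.mk' ℂ m (σ m))) :
    ContMDiff I (I.prod 𝓘(ℝ, E →L[ℝ] ℝ)) ∞
      (fun m => TotalSpace.mk' (E →L[ℝ] ℝ)
        (E := fun m : M => TangentSpace I m →L[ℝ] Bundle.Trivial M ℝ m) m
        (connectionForm nabla σ m)) := by
  obtain ⟨g, hg, hgi⟩ := hL.contMDiffMetric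
  have hn := nabla.smooth.contMDiff.contMDiff (σ := σ) hσ.contMDiffOn
  intro m₀
  have h1 := ((contMDiffAt_hom_bundle _).1 ((hn m₀ trivial).contMDiffAt Filter.univ_mem)).2
  have h2 := ((contMDiffAt_hom_bundle _).1 ((hg.clm_bundle_apply hσ) m₀)).2
  have h3 := (ContMDiffAt.clm_comp (contMDiffAt_const
    (c := Complex.reCLM.comp (ContinuousLinearMap.mul ℝ ℂ Complex.I))) (h2.clm_comp h1))
  refine (contMDiffAt_hom_bundle _).2 ⟨contMDiffAt_id, h3.congr_of_eventuallyEq ?_⟩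
  filter_upwards [(trivializationAt ℂ L m₀).open_baseSet.mem_nhds
    (FiberBundle.mem_baseSet_trivializationAt' m₀)] with m hm
  ext v
  have h4 := fun w : L m => (trivializationAt ℂ L m₀).symmL_continuousLinearMapAt (R := ℝ) hm w
  simp only [Trivialization.continuousLinearMapAt_apply] at h4
  simp [ContinuousLinearMap.inCoordinates, connectionForm_apply, hgi, h4]

/-- The coordinate with respect to a smooth unit frame, as a unitary map to `ℂ`. -/
def frameIso [IsHermitianLineBundle I L] {m : M} (e : L m) (he : ‖e‖ = 1) : L m ≃ₗᵢ[ℂ] ℂ where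
  toFun v := inner ℂ e v
  map_add' := inner_add_right e
  map_smul' c v := inner_smul_right e v c
  invFun z := z • e
  left_inv := inner_smul_frame (I := I) he
  right_inv := inner_smul_of_norm_eq_one he
  norm_map' v := by
    conv_rhs => rw [← inner_smul_frame (I := I) he v, norm_smul, he, mul_one]
    rfl

variable [MulAction ℤˣ M]

/-- The connection form of a frame on which the group acts by a character is invariant. -/
lemma connectionForm_invariant [hL : IsHermitianLineBundle I L] (ρ : EquivariantStructure nabla)
    {σ : ∀ m, L m} {s : ℤˣ} (hσ1 : ∀ m, ‖σ m‖ = 1)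
    (hσ : ContMDiff I (I.prod 𝓘(ℝ, ℂ)) ∞ (fun m => TotalSpace.mk' ℂ m (σ m)))
    (hρ : ∀ ζ m, ρ.toFun ζ m (σ m) = character s ζ • σ (ζ • m)) (ζ : ℤˣ) (m : M)
    (v : TangentSpace I m) :
    connectionForm nabla σ (ζ • m) (mfderiv I I (fun m' : M => ζ • m') m v) =
      connectionForm nabla σ m v := by
  have hd : ∀ m, MDifferentiableAt I (I.prod 𝓘(ℝ, ℂ)) (fun m => TotalSpace.mk' ℂ m (σ m)) m :=
    fun m => (hσ m).mdifferentiableAt (by simp)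
  have hc := character_ne_zero s ζ
  have h1 := ρ.connection ζ m σ (hd _) v
  have h2 : (fun m' => (ρ.toFun ζ m').symm (σ (ζ • m'))) =
      fun m' => (fun _ : M => (character s ζ)⁻¹) m' • σ m' := by
    funext m'
    rw [LinearIsometryEquiv.symm_apply_eq, map_smul, hρ, smul_smul, inv_mul_cancel₀ hc, one_smul]
  rw [h2, nabla.leibniz_complex _ σ m mdifferentiableAt_const (hd m), mvfderiv_const,
    zero_apply, zero_smul, add_zero, map_smul] at h1
  rw [connectionForm_apply, connectionForm_apply, ← h1,
    ← inner_smul_frame (I := I) (hσ1 m) (nabla.toFun σ m v), map_smul, hρ, inner_smul_right,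
    inner_smul_right, inner_smul_of_norm_eq_one (hσ1 _), inner_smul_of_norm_eq_one (hσ1 _)]
  field_simp

end ConnectionForm

end Z2Bundle

end

theorem mainTheorem7
    {E : Type*} [NormedAddCommGroup E] [NormedSpace ℝ E] [FiniteDimensional ℝ E]
    {H : Type*} [TopologicalSpace H] (I : ModelWithCorners ℝ E H)
    {M : Type*} [TopologicalSpace M] [ChartedSpace H M] [IsManifold I ∞ M]
    [T2Space M] [SigmaCompactSpace M]
    [MulAction ℤˣ M] [Z2Bundle.IsSmoothAction I M]
    (hM : Z2Bundle.IsTwoConnected M)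
    (L : M → Type*) [∀ m, NormedAddCommGroup (L m)] [∀ m, InnerProductSpace ℂ (L m)]
    [TopologicalSpace (Bundle.TotalSpace ℂ L)] [FiberBundle ℂ L] [VectorBundle ℝ ℂ L]
    [Z2Bundle.IsHermitianLineBundle I L]
    (nabla : Z2Bundle.UnitaryConnection I L)
    (ρ : Z2Bundle.EquivariantStructure nabla) :
    ∃ (A : Z2Bundle.InvariantOneForm I M) (s : ℤˣ),
      Nonempty (Z2Bundle.EquivariantIso ρ (Z2Bundle.trivialAction A s)) := by
  obtain ⟨σ, s, hσ1, hσ, hρ⟩ := Z2Bundle.exists_equivariant_frame (I := I) hM ρ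
  refine ⟨⟨Z2Bundle.connectionForm nabla σ, Z2Bundle.contMDiff_connectionForm hσ,
    Z2Bundle.connectionForm_invariant ρ hσ1 hσ hρ⟩, s, ⟨?_⟩⟩
  have := (inferInstance : Z2Bundle.IsHermitianLineBundle I L).vectorBundle_complex
  have hσ0 : ∀ m, σ m ≠ 0 := fun m h => by simpa [h] using hσ1 m
  have hpr : ContMDiff (I.prod 𝓘(ℝ, ℂ)) I ∞ (fun p : TotalSpace ℂ L => p.proj) :=
    contMDiff_proj L
  have hpr' : ContMDiff (I.prod 𝓘(ℝ, ℂ)) I ∞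
      (fun p : TotalSpace ℂ (Bundle.Trivial M ℂ) => p.proj) := contMDiff_proj _
  refine
    { toFun := fun m => Z2Bundle.frameIso (I := I) (σ m) (hσ1 m)
      smooth := fun p => contMDiffAt_totalSpace.2 ⟨hpr p, ?_⟩
      smooth_symm := fun p => Z2Bundle.contMDiffAt_smul (b := fun p => p.proj)
        ((hσ.comp hpr') p) (contMDiffAt_totalSpace.1 contMDiffAt_id).2
      connection := fun m τ hτ v => ?_
      equivariant := fun ζ m z => ?_ }
  · exact Z2Bundle.contMDiffAt_of_smul_eq (b := fun p : TotalSpace ℂ L => p.proj)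
      (v := fun p => p.snd) (w := fun p => σ p.proj) contMDiffAt_id ((hσ.comp hpr) p)
      (Filter.Eventually.of_forall fun p => hσ0 p.proj)
      (Filter.Eventually.of_forall fun p =>
        Z2Bundle.inner_smul_frame (I := I) (hσ1 p.proj) p.snd)
  · have hφ := Z2Bundle.mdifferentiableAt_inner_frame hσ1 hσ hτ
    have h1 := nabla.leibniz_complex (fun m => (inner ℂ (σ m) (τ m) : ℂ)) σ m hφ
      ((hσ m).mdifferentiableAt (by simp)) v
    have h2 : (fun m => (inner ℂ (σ m) (τ m) : ℂ) • σ m) = τ :=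
      funext fun m => Z2Bundle.inner_smul_frame (I := I) (hσ1 m) (τ m)
    rw [h2] at h1
    change mvfderiv I (fun m => (inner ℂ (σ m) (τ m) : ℂ)) m v +
      Z2Bundle.connectionForm nabla σ m v • (1 / Complex.I * inner ℂ (σ m) (τ m)) =
        inner ℂ (σ m) (nabla.toFun τ m v)
    rw [h1, inner_add_right, Z2Bundle.inner_smul_of_norm_eq_one (hσ1 m), inner_smul_right,
      Z2Bundle.inner_nabla hσ1 hσ, Complex.real_smul]
    ring
  · change inner ℂ (σ (ζ • m)) (ρ.toFun ζ m z) = Z2Bundle.character s ζ * inner ℂ (σ m) z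
    rw [← Z2Bundle.inner_smul_frame (I := I) (hσ1 m) z, map_smul, hρ, inner_smul_right,
      Z2Bundle.inner_smul_of_norm_eq_one (hσ1 _), Z2Bundle.inner_smul_of_norm_eq_one (hσ1 _),
      mul_comm]
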